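/- For a submonoid $\mathcal{S}$ of $(\mathbb{N},+)$, order $\mathcal{S}$ by $x\le_{\mathcal{S}} y \iff y-x\in\mathcal{S}$; the global minimum of this poset is $0$. In the game of chomp on $(\mathcal{S},\le_{\mathcal{S}})$ two players $A$ and $B$ alternately pick an element $x$ of the remaining poset and remove its up-set $\{y : x\le_{\mathcal{S}} y\}$; player $A$ moves first, and whoever picks $0$ loses. Proposition. Let $a\ge 4$ be an integer and let $\mathcal{S}=\langle a,a+1,\ldots,2a-3\rangle$ be the submonoid of $\mathbb{N}$ generated by $a,a+1,\ldots,2a-3$. Player $A$ has a winning strategy for chomp on $(\mathcal{S},\le_{\mathcal{S}})$ if and only if $a$ is odd or $a=6$. -/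

import Mathlib

/-- The submonoid `S` of `ℕ`, viewed as the poset in which `x ≤ y` means `y - x ∈ S`. (This is a
type synonym, so that the usual order of `ℕ` is not used.) -/
def SemigroupPoset (S : AddSubmonoid ℕ) : Type := {n : ℕ // n ∈ S}

namespace SemigroupPoset

/-- `x ≤ y` if and only if `y = x + s` for some `s ∈ S`. -/
instance instPartialOrder (S : AddSubmonoid ℕ) : PartialOrder (SemigroupPoset S) where
  le x y := ∃ s ∈ S, x.1 + s = y.1
  le_refl x := ⟨0, S.zero_mem, Nat.add_zero _⟩
  le_trans x y z := by
    rintro ⟨s, hs, h₁⟩ ⟨t, ht, h₂⟩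
    exact ⟨s + t, S.add_mem hs ht, by omega⟩
  le_antisymm x y := by
    rintro ⟨s, _, h₁⟩ ⟨t, _, h₂⟩
    exact Subtype.ext (by omega)

/-- The global minimum is `0`. -/
instance instOrderBot (S : AddSubmonoid ℕ) : OrderBot (SemigroupPoset S) where
  bot := ⟨0, S.zero_mem⟩
  bot_le x := ⟨x.1, x.2, Nat.zero_add _⟩

end SemigroupPoset

/-- The submonoid `⟨a, a + 1, …, b⟩` of `ℕ` generated by the integers of the interval `[a, b]`. -/
def intervalSemigroup (a b : ℕ) : AddSubmonoid ℕ := AddSubmonoid.closure (Set.Icc a b)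

namespace Chomp

/-- The elements that are left when the elements of the list `h` have been picked: those that are
not in the up-set of any picked element. A move is legal if and only if it picks such an element. -/
def remaining {P : Type*} [PartialOrder P] (h : List P) : Set P := {z | ∀ x ∈ h, ¬ x ≤ z}

/-- The history (list of all moves of both players, latest move first) after `n` full rounds, when
player `A`, who moves first, plays according to the strategy `σ`, and player `B` picks `b k` in
round `k`. A strategy for `A` tells which element to pick, given the history. -/
def history {P : Type*} (σ : List P → P) (b : ℕ → P) : ℕ → List P
  | 0 => []
  | n + 1 => b n :: σ (history σ b n) :: history σ b n

/-- The moves `b` of player `B` against `σ` are legal, as long as the game is not over, that is,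
as long as the minimum has not been picked. -/
def LegalReplies {P : Type*} [PartialOrder P] [OrderBot P] (σ : List P → P) (b : ℕ → P) : Prop :=
  ∀ n, ⊥ ∉ σ (history σ b n) :: history σ b n →
    b n ∈ remaining (σ (history σ b n) :: history σ b n)

/-- The strategy `σ` is winning for player `A`: however `B` plays, after finitely many rounds `B`
picks the minimum, and up to then `A` has made legal moves only and has not picked the minimum. -/
def IsWinningStrategy {P : Type*} [PartialOrder P] [OrderBot P] (σ : List P → P) : Prop :=
  ∀ b : ℕ → P, LegalReplies σ b →
    ∃ n, b n = ⊥ ∧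
      ∀ k ≤ n, σ (history σ b k) ∈ remaining (history σ b k) ∧ σ (history σ b k) ≠ ⊥

/-- Player `A`, who moves first, has a winning strategy for chomp on `P`. -/
def PlayerAWins (P : Type*) [PartialOrder P] [OrderBot P] : Prop :=
  ∃ σ : List P → P, IsWinningStrategy σ

end Chomp

/-!
A family of positions is closed if every move (other than `0`) from a member can be answered by a
move (other than `0`) back into the family; its members are lost for the player to move. So `A`
wins if some first move leaves a member of a closed family (`playerAWins_of_lost`), and does not
win if every first move can be answered by a move to one (`not_playerAWins_of_lost`).

* For `a = 4` the semigroup `⟨4, 5⟩` is symmetric: whatever `x` is picked first, what is left has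
  the greatest element `x + 11`, and `B` wins by strategy stealing (`not_playerAWins_four`).
* For odd `a` the first move `a` leaves a poset of height three that is lost by a parity argument
  (`playerAWins_of_odd`).
* For `a = 6` the first move `36` wins. This has no pattern, and is checked by computation with
  an explicit closed family of positions, encoded in binary (`playerAWins_six`).
* For even `a ≥ 8` player `B` has an answer to every first move (`not_playerAWins_of_even`). For
  `a ≥ 5` the elements of the semigroup are `0`, those of `[a, 2a - 3]`, and all `n ≥ 2a`. Hence,
  if `x` is the least element removed, the elements left above `x` lie in the window `(x, x + a)`,
  except possibly for `x + 2a - 2` and `x + 2a - 1`. Those in the window are maximal, so that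
  parities matter: removing two of them is a pair of moves that does not change the structure.
  Nothing is removed below `x`, and the outcomes are periodic in `x` with period `2a + 1`. The
  closed family `Target` has seven kinds of members, according to the place of `x` in the period
  that begins with a base `b`, where `b ∈ {a, a + (2a + 1), a + 2(2a + 1), …}`. If `2 ≤ j ≤ a - 2`,
  then `b` and `b + j` together remove everything from `b + a` on, and leave an even number of
  elements in the window; the same holds for `b + a` and `b + a + j`. Together with a few special
  answers, this takes care of all moves in complete periods (`answer_of_period`). The moves near
  the least element removed are treated for each kind of target separately
  (`isClosedFamily_target`).
-/

/-! ### Closed families and strategies -/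

namespace Chomp

/-- The position that is left of `Q` when `z` has been picked, in chomp on the submonoid `S`. -/
def bite (S : AddSubmonoid ℕ) (Q : Set ℕ) (z : ℕ) : Set ℕ := {w ∈ Q | ¬ ∃ s ∈ S, z + s = w}

/-- A family of positions is closed if every move other than `0` from one of its members can be
answered by a move other than `0` that leads back into the family. -/
def IsClosedFamily (S : AddSubmonoid ℕ) (F : Set (Set ℕ)) : Prop :=
  ∀ Q ∈ F, ∀ z ∈ Q, z ≠ 0 → ∃ y ∈ bite S Q z, y ≠ 0 ∧ bite S (bite S Q z) y ∈ F

/-- A position is lost for the player to move if it belongs to a closed family. Infinite play is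
not excluded here, so the name is justified for finite positions only. -/
def Lost (S : AddSubmonoid ℕ) (Q : Set ℕ) : Prop := ∃ F, IsClosedFamily S F ∧ Q ∈ F

variable {S : AddSubmonoid ℕ}

theorem Lost.exists_reply {Q : Set ℕ} (h : Lost S Q) {z : ℕ} (hz : z ∈ Q) (hz0 : z ≠ 0) :
    ∃ y ∈ bite S Q z, y ≠ 0 ∧ Lost S (bite S (bite S Q z) y) := by
  obtain ⟨F, hF, hQ⟩ := h
  obtain ⟨y, hy, hy0, hyF⟩ := hF Q hQ z hz hz0
  exact ⟨y, hy, hy0, F, hF, hyF⟩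

theorem Lost.of_exists_reply {Q : Set ℕ}
    (h : ∀ z ∈ Q, z ≠ 0 → ∃ y ∈ bite S Q z, y ≠ 0 ∧ Lost S (bite S (bite S Q z) y)) :
    Lost S Q := by
  refine ⟨{R | Lost S R ∨ R = Q}, ?_, Or.inr rfl⟩
  rintro R (hR | rfl) z hz hz0
  · obtain ⟨y, hy, hy0, hl⟩ := hR.exists_reply hz hz0
    exact ⟨y, hy, hy0, Or.inl hl⟩
  · obtain ⟨y, hy, hy0, hl⟩ := h z hz hz0
    exact ⟨y, hy, hy0, Or.inl hl⟩

theorem notMem_bite_self (S : AddSubmonoid ℕ) (Q : Set ℕ) (z : ℕ) : z ∉ bite S Q z :=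
  fun h => h.2 ⟨0, S.zero_mem, rfl⟩

theorem bite_subset (S : AddSubmonoid ℕ) (Q : Set ℕ) (z : ℕ) : bite S Q z ⊆ Q := fun _ h => h.1

theorem bite_ssubset {Q : Set ℕ} {z : ℕ} (hz : z ∈ Q) : bite S Q z ⊂ Q :=
  ⟨bite_subset S Q z, fun h => notMem_bite_self S Q z (h hz)⟩

/-- Finite positions are determined. -/
theorem lost_or_exists_lost {Q : Set ℕ} (hQ : Q.Finite) :
    Lost S Q ∨ ∃ z ∈ Q, z ≠ 0 ∧ Lost S (bite S Q z) := by
  induction hn : Q.ncard using Nat.strong_induction_on generalizing Q with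
  | _ n ih =>
    by_cases hw : ∃ z ∈ Q, z ≠ 0 ∧ Lost S (bite S Q z)
    · exact Or.inr hw
    · refine Or.inl (Lost.of_exists_reply fun z hz hz0 => ?_)
      have hlt : (bite S Q z).ncard < n := hn ▸ Set.ncard_lt_ncard (bite_ssubset hz) hQ
      rcases ih _ hlt (hQ.subset (bite_subset S Q z)) rfl with h | h
      · exact absurd ⟨z, hz, hz0, h⟩ hw
      · exact h

/-- Strategy stealing: in a finite position with a greatest element `q ≠ 0`, the player to move has
a winning move. Either picking `q` wins, or the move that wins once `q` is gone wins right away,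
because it removes `q` as well. -/
theorem exists_lost_bite_of_greatest {Q : Set ℕ} (hQ : Q.Finite) {q : ℕ} (hq : q ∈ Q) (hq0 : q ≠ 0)
    (hmax : ∀ z ∈ Q, ∃ s ∈ S, z + s = q) : ∃ z ∈ Q, z ≠ 0 ∧ Lost S (bite S Q z) := by
  rcases lost_or_exists_lost (S := S) (hQ.subset (bite_subset S Q q)) with h | ⟨z, hz, hz0, h⟩
  · exact ⟨q, hq, hq0, h⟩
  · refine ⟨z, hz.1, hz0, ?_⟩
    have heq : bite S (bite S Q q) z = bite S Q z := by
      ext w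
      refine ⟨fun hw => ⟨hw.1.1, hw.2⟩, fun hw => ⟨⟨hw.1, ?_⟩, hw.2⟩⟩
      rintro ⟨t, ht, rfl⟩
      obtain ⟨s, hs, rfl⟩ := hmax z hz.1
      exact hw.2 ⟨s + t, S.add_mem hs ht, by omega⟩
    rwa [heq] at h

/-- The position after the moves `h`, as a set of natural numbers. -/
def position (h : List (SemigroupPoset S)) : Set ℕ := {n | ∃ p ∈ remaining h, p.1 = n}

theorem position_nil : position ([] : List (SemigroupPoset S)) = S := by
  ext n
  constructor
  · rintro ⟨p, -, rfl⟩
    exact p.2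
  · exact fun hn => ⟨⟨n, hn⟩, fun _ hx => absurd hx List.not_mem_nil, rfl⟩

theorem position_cons (z : SemigroupPoset S) (h : List (SemigroupPoset S)) :
    position (z :: h) = bite S (position h) z.1 := by
  ext n
  constructor
  · rintro ⟨p, hp, rfl⟩
    exact ⟨⟨p, fun x hx => hp x (List.mem_cons_of_mem _ hx), rfl⟩, hp z List.mem_cons_self⟩
  · rintro ⟨⟨p, hp, rfl⟩, hz⟩
    refine ⟨p, fun x hx => ?_, rfl⟩
    rcases List.mem_cons.1 hx with rfl | hx
    · exact hz
    · exact hp x hx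

theorem mem_remaining_iff {h : List (SemigroupPoset S)} {p : SemigroupPoset S} :
    p ∈ remaining h ↔ p.1 ∈ position h :=
  ⟨fun hp => ⟨p, hp, rfl⟩, fun ⟨_, hq, he⟩ => Subtype.ext he ▸ hq⟩

theorem bot_notMem_of_mem_position {h : List (SemigroupPoset S)} {n : ℕ} (hn : n ∈ position h) :
    ⊥ ∉ h := by
  obtain ⟨p, hp, -⟩ := hn
  exact fun hb => hp _ hb bot_le

theorem bot_mem_remaining {h : List (SemigroupPoset S)} (hb : ⊥ ∉ h) : ⊥ ∈ remaining h :=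
  fun _ hx hle => hb (le_bot_iff.1 hle ▸ hx)

theorem val_ne_zero_iff {p : SemigroupPoset S} : p.1 ≠ 0 ↔ p ≠ ⊥ :=
  not_congr ⟨fun h => Subtype.ext h, fun h => congrArg Subtype.val h⟩

/-- The move `y` after the moves `h` is legal, does not pick `0`, and leaves a lost position. -/
def IsGoodMove (h : List (SemigroupPoset S)) (y : SemigroupPoset S) : Prop :=
  y.1 ∈ position h ∧ y.1 ≠ 0 ∧ Lost S (bite S (position h) y.1)

open Classical in
/-- A strategy for either player: make a good move if there is one, and give up otherwise. -/
noncomputable def goodMove (h : List (SemigroupPoset S)) : SemigroupPoset S :=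
  if hy : ∃ y, IsGoodMove h y then hy.choose else ⊥

theorem isGoodMove_goodMove {h : List (SemigroupPoset S)} (hy : ∃ y, IsGoodMove h y) :
    IsGoodMove h (goodMove h) := by
  rw [goodMove, dif_pos hy]
  exact hy.choose_spec

theorem exists_isGoodMove_iff {h : List (SemigroupPoset S)} :
    (∃ y, IsGoodMove h y) ↔ ∃ y ∈ position h, y ≠ 0 ∧ Lost S (bite S (position h) y) := by
  constructor
  · rintro ⟨y, hy⟩
    exact ⟨y.1, hy⟩
  · rintro ⟨_, ⟨p, hp, rfl⟩, hy⟩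
    exact ⟨p, ⟨p, hp, rfl⟩, hy⟩

theorem exists_isGoodMove_of_lost {h : List (SemigroupPoset S)} (hl : Lost S (position h))
    {z : SemigroupPoset S} (hz : z ∈ remaining h) (hz0 : z ≠ ⊥) : ∃ y, IsGoodMove (z :: h) y := by
  rw [exists_isGoodMove_iff, position_cons]
  exact hl.exists_reply (mem_remaining_iff.1 hz) (val_ne_zero_iff.2 hz0)

/-- Player `A` wins if some first move leaves a lost position. -/
theorem playerAWins_of_lost (hfin : ∀ x ∈ S, x ≠ 0 → (bite S S x).Finite) {x : ℕ} (hx : x ∈ S)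
    (hx0 : x ≠ 0) (hl : Lost S (bite S S x)) : PlayerAWins (SemigroupPoset S) := by
  refine ⟨goodMove, fun b hb => ?_⟩
  have hgood : ∀ n, (∀ k < n, b k ≠ ⊥) → ∃ y, IsGoodMove (history goodMove b n) y := by
    intro n
    induction n with
    | zero =>
      intro _
      rw [history, exists_isGoodMove_iff, position_nil]
      exact ⟨x, hx, hx0, hl⟩
    | succ n ih =>
      intro hn
      have hy := isGoodMove_goodMove (ih fun k hk => hn k (by omega))
      have hbot : ⊥ ∉ goodMove (history goodMove b n) :: history goodMove b n := by
        rw [List.mem_cons, not_or]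
        exact ⟨(val_ne_zero_iff.1 hy.2.1).symm, bot_notMem_of_mem_position hy.1⟩
      refine exists_isGoodMove_of_lost ?_ (hb n hbot) (hn n (by omega))
      rw [position_cons]
      exact hy.2.2
  have hend : ∃ n, b n = ⊥ := by
    by_contra! hne
    -- The position after the first round is finite, and every later round shrinks it.
    set f : ℕ → ℕ := fun n => (position (history goodMove b (n + 1))).ncard with hf
    have hmove n := isGoodMove_goodMove (hgood n fun k _ => hne k)
    have hsub : ∀ n, position (history goodMove b (n + 1)) ⊆
        bite S (position (history goodMove b n)) (goodMove (history goodMove b n)).1 := by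
      intro n
      rw [history, position_cons, position_cons]
      exact bite_subset _ _ _
    have hfinite : ∀ n, (position (history goodMove b (n + 1))).Finite := by
      intro n
      induction n with
      | zero =>
        refine Set.Finite.subset ?_ (hsub 0)
        rw [history, position_nil]
        exact hfin _ (goodMove []).2 (hmove 0).2.1
      | succ n ih => exact ih.subset ((hsub (n + 1)).trans (bite_subset _ _ _))
    have hlt : ∀ n, f (n + 1) < f n := fun n =>
      Set.ncard_lt_ncard ((hsub (n + 1)).trans_ssubset (bite_ssubset (hmove (n + 1)).1)) (hfinite n)
    have hle : ∀ n, f n + n ≤ f 0 := by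
      intro n
      induction n with
      | zero => simp
      | succ n ih => have := hlt n; omega
    have := hle (f 0 + 1)
    omega
  classical
  refine ⟨Nat.find hend, Nat.find_spec hend, fun k hk => ?_⟩
  have hy := isGoodMove_goodMove (hgood k fun j hj => Nat.find_min hend (by omega))
  exact ⟨mem_remaining_iff.2 hy.1, val_ne_zero_iff.1 hy.2.1⟩

/-- Player `A` does not win if every first move has an answer that leaves a lost position. -/
theorem not_playerAWins_of_lost
    (h : ∀ x ∈ S, x ≠ 0 → ∃ y ∈ bite S S x, y ≠ 0 ∧ Lost S (bite S (bite S S x) y)) :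
    ¬ PlayerAWins (SemigroupPoset S) := by
  rintro ⟨σ, hσ⟩
  let H : ℕ → List (SemigroupPoset S) :=
    fun n => n.rec [] fun _ l => goodMove (σ l :: l) :: σ l :: l
  have hH : ∀ n, history σ (fun k => goodMove (σ (H k) :: H k)) n = H n := by
    intro n
    induction n with
    | zero => rfl
    | succ n ih => rw [history, ih]
  have hlegal : LegalReplies σ fun k => goodMove (σ (H k) :: H k) := by
    intro n hn
    rw [hH] at hn ⊢
    by_cases hy : ∃ y, IsGoodMove (σ (H n) :: H n) y
    · exact mem_remaining_iff.2 (isGoodMove_goodMove hy).1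
    · have he : goodMove (σ (H n) :: H n) = ⊥ := by rw [goodMove, dif_neg hy]
      simp only [he]
      exact bot_mem_remaining hn
  obtain ⟨n, hn, hA⟩ := hσ _ hlegal
  simp only [hH] at hA
  have key : ∀ k ≤ n, ∃ y, IsGoodMove (σ (H k) :: H k) y := by
    intro k
    induction k with
    | zero =>
      intro hk
      have hz := hA 0 hk
      rw [exists_isGoodMove_iff, position_cons, show H 0 = [] from rfl, position_nil]
      exact h _ (σ []).2 (val_ne_zero_iff.2 hz.2)
    | succ k ih =>
      intro hk
      have hy := isGoodMove_goodMove (ih (by omega))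
      have hz := hA (k + 1) hk
      refine exists_isGoodMove_of_lost ?_ hz.1 hz.2
      rw [show H (k + 1) = goodMove (σ (H k) :: H k) :: σ (H k) :: H k from rfl, position_cons]
      exact hy.2.2
  exact val_ne_zero_iff.1 (isGoodMove_goodMove (key n le_rfl)).2.1 hn

/-! ### The semigroup in explicit form -/

/-- For `a ≥ 5`, this is the order `z ≤ w` of `⟨a, …, 2a - 3⟩` in explicit form
(see `mem_intervalSemigroup_iff`). -/
def Above (a z w : ℕ) : Prop := w = z ∨ (z + a ≤ w ∧ w + 3 ≤ z + 2 * a) ∨ z + 2 * a ≤ w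

theorem mem_intervalSemigroup_iff {a n : ℕ} (ha : 5 ≤ a) :
    n ∈ intervalSemigroup a (2 * a - 3) ↔ Above a 0 n := by
  constructor
  · intro h
    induction h using AddSubmonoid.closure_induction with
    | mem x hx => rw [Set.mem_Icc] at hx; unfold Above; omega
    | zero => exact Or.inl rfl
    | add x y _ _ hx hy => unfold Above at *; omega
  · have hgen : ∀ m, a ≤ m → m + 3 ≤ 2 * a → m ∈ intervalSemigroup a (2 * a - 3) :=
      fun m h₁ h₂ => AddSubmonoid.subset_closure (Set.mem_Icc.2 ⟨h₁, by omega⟩)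
    rintro (rfl | ⟨h₁, h₂⟩ | h)
    · exact zero_mem _
    · exact hgen n (by omega) (by omega)
    · rw [zero_add] at h
      induction n using Nat.strong_induction_on with
      | _ n ih =>
        by_cases h₃ : 3 * a ≤ n
        · have := add_mem (ih (n - a) (by omega) (by omega)) (hgen a le_rfl (by omega))
          rwa [Nat.sub_add_cancel (by omega)] at this
        · -- The sums of two generators cover `[2a, 4a - 6]`, which contains `[2a, 3a - 1]`.
          by_cases h₄ : n + 3 ≤ 3 * a
          · have := add_mem (hgen (n - a) (by omega) (by omega)) (hgen a le_rfl (by omega))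
            rwa [Nat.sub_add_cancel (by omega)] at this
          · have := add_mem (hgen (n - (a + 2)) (by omega) (by omega))
              (hgen (a + 2) (by omega) (by omega))
            rwa [Nat.sub_add_cancel (by omega)] at this

theorem mem_bite_iff {a z w : ℕ} {Q : Set ℕ} (ha : 5 ≤ a) :
    w ∈ bite (intervalSemigroup a (2 * a - 3)) Q z ↔ w ∈ Q ∧ ¬ Above a z w := by
  refine and_congr_right fun _ => not_congr ⟨?_, fun h => ⟨w - z, ?_, ?_⟩⟩
  · rintro ⟨s, hs, rfl⟩
    rw [mem_intervalSemigroup_iff ha] at hs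
    unfold Above at *
    omega
  · rw [mem_intervalSemigroup_iff ha]
    unfold Above at *
    omega
  · unfold Above at h
    omega

theorem finite_bite {a x : ℕ} (ha : 5 ≤ a) {Q : Set ℕ} :
    (bite (intervalSemigroup a (2 * a - 3)) Q x).Finite := by
  refine (Set.finite_Iio (x + 2 * a)).subset fun w hw => ?_
  have := ((mem_bite_iff ha).1 hw).2
  unfold Above at this
  rw [Set.mem_Iio]
  omega

/-! ### The symmetric case `a = 4` -/

theorem mem_intervalSemigroup_four_iff {n : ℕ} : n ∈ intervalSemigroup 4 5 ↔
    n = 0 ∨ n = 4 ∨ n = 5 ∨ n = 8 ∨ n = 9 ∨ n = 10 ∨ 12 ≤ n := by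
  constructor
  · intro h
    induction h using AddSubmonoid.closure_induction with
    | mem x hx => rw [Set.mem_Icc] at hx; omega
    | zero => exact Or.inl rfl
    | add x y _ _ hx hy => omega
  · have h4 : 4 ∈ intervalSemigroup 4 5 := AddSubmonoid.subset_closure (by simp)
    have h5 : 5 ∈ intervalSemigroup 4 5 := AddSubmonoid.subset_closure (by simp)
    have h8 := add_mem h4 h4
    have h9 := add_mem h4 h5
    have h10 := add_mem h5 h5
    rintro (rfl | rfl | rfl | rfl | rfl | rfl | h)
    · exact zero_mem _
    · exact h4
    · exact h5
    · exact h8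
    · exact h9
    · exact h10
    · induction n using Nat.strong_induction_on with
      | _ n ih =>
        by_cases hn : 16 ≤ n
        · have := add_mem (ih (n - 4) (by omega) (by omega)) h4
          rwa [Nat.sub_add_cancel (by omega)] at this
        · have : n = 12 ∨ n = 13 ∨ n = 14 ∨ n = 15 := by omega
          rcases this with rfl | rfl | rfl | rfl
          · exact add_mem h8 h4
          · exact add_mem h9 h4
          · exact add_mem h10 h4
          · exact add_mem h10 h5

/-- `⟨4, 5⟩` is symmetric with Frobenius number `11`, so that whatever `x ≠ 0` is picked first,
`x + 11` is the greatest element of what is left, and player `B` can steal the strategy. -/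
theorem not_playerAWins_four : ¬ PlayerAWins (SemigroupPoset (intervalSemigroup 4 5)) := by
  refine not_playerAWins_of_lost fun x hx hx0 => ?_
  have hbite : ∀ w, w ∈ bite (intervalSemigroup 4 5) (intervalSemigroup 4 5) x ↔
      w ∈ intervalSemigroup 4 5 ∧ ∀ s ∈ intervalSemigroup 4 5, x + s ≠ w := by
    simp [bite]
  refine exists_lost_bite_of_greatest (q := x + 11) ?_ ?_ (by omega) fun z hz => ⟨x + 11 - z, ?_⟩
  · refine (Set.finite_Iio (x + 12)).subset fun w hw => ?_
    by_contra hlt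
    rw [Set.mem_Iio, not_lt] at hlt
    exact ((hbite w).1 hw).2 (w - x) (mem_intervalSemigroup_four_iff.2 (by omega)) (by omega)
  · rw [mem_intervalSemigroup_four_iff] at hx
    refine (hbite _).2 ⟨mem_intervalSemigroup_four_iff.2 (by omega), fun s hs h => ?_⟩
    rw [mem_intervalSemigroup_four_iff] at hs
    omega
  · obtain ⟨-, hz⟩ := (hbite z).1 hz
    have hzx : x ≤ z → ¬ (z - x = 0 ∨ z - x = 4 ∨ z - x = 5 ∨ z - x = 8 ∨ z - x = 9 ∨ z - x = 10 ∨
        12 ≤ z - x) :=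
      fun hle h => hz (z - x) (mem_intervalSemigroup_four_iff.2 h) (by omega)
    rw [mem_intervalSemigroup_four_iff]
    omega

/-! ### Positions with a window -/

instance (a z w : ℕ) : Decidable (Above a z w) := by unfold Above; infer_instance

/-- The position that consists of all elements of the semigroup below `x` and of those in `T`. -/
def pos (a x : ℕ) (T : Finset ℕ) : Set ℕ := {w | Above a 0 w ∧ (w < x ∨ w ∈ T)}

theorem mem_pos {a x w : ℕ} {T : Finset ℕ} :
    w ∈ pos a x T ↔ Above a 0 w ∧ (w < x ∨ w ∈ T) := Iff.rfl

/-- The elements of `T` are maximal in `pos a x T` if they lie in the window `(x, x + a)`. -/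
theorem bite_pos {a x t : ℕ} {T : Finset ℕ} (ha : 5 ≤ a) (hT : ∀ w ∈ T, x < w ∧ w < x + a)
    (ht : t ∈ T) :
    bite (intervalSemigroup a (2 * a - 3)) (pos a x T) t = pos a x (T.erase t) := by
  ext w
  rw [mem_bite_iff ha, mem_pos, mem_pos, Finset.mem_erase]
  have := hT t ht
  unfold Above
  grind

theorem card_erase_mod_two {T : Finset ℕ} {t : ℕ} (ht : t ∈ T) :
    (T.erase t).card % 2 = (T.card + 1) % 2 := by
  have := Finset.card_erase_add_one ht
  omega

theorem nonempty_of_odd {T : Finset ℕ} (h : T.card % 2 = 1) : T.Nonempty := by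
  rw [← Finset.card_pos]
  omega

theorem exists_mem_notMem_erase {T : Finset ℕ} (h : T.card % 2 = 1) (n : ℕ) :
    ∃ t ∈ T, n ∉ T.erase t := by
  by_cases hn : n ∈ T
  · exact ⟨n, hn, Finset.notMem_erase _ _⟩
  · obtain ⟨t, ht⟩ := nonempty_of_odd h
    exact ⟨t, ht, fun h' => hn (Finset.mem_of_mem_erase h')⟩

/-! ### Lost positions for even `a ≥ 8` -/

/-- The bases `a`, `a + (2a + 1)`, `a + 2(2a + 1)`, … of the periods of the strategy. -/
def IsBase (a b : ℕ) : Prop := ∃ k, b = a + k * (2 * a + 1)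

theorem IsBase.le {a b : ℕ} (h : IsBase a b) : a ≤ b := by
  obtain ⟨k, rfl⟩ := h
  exact Nat.le_add_right _ _

theorem IsBase.eq_or_exists {a b : ℕ} (h : IsBase a b) :
    b = a ∨ ∃ b', IsBase a b' ∧ b = b' + 2 * a + 1 := by
  obtain ⟨k, rfl⟩ := h
  cases k with
  | zero => simp
  | succ k => exact Or.inr ⟨_, ⟨k, rfl⟩, by ring⟩

theorem exists_isBase_le {a z : ℕ} (hz : a ≤ z) : ∃ b, IsBase a b ∧ b ≤ z ∧ z ≤ b + 2 * a := by
  refine ⟨_, ⟨(z - a) / (2 * a + 1), rfl⟩, ?_, ?_⟩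
  · have := Nat.div_mul_le_self (z - a) (2 * a + 1)
    omega
  · have := Nat.lt_div_mul_add (a := z - a) (b := 2 * a + 1) (by omega)
    omega

/-- The elements of the semigroup strictly between `b + i` and `b + a`. -/
def window (a b i : ℕ) : Finset ℕ := {w ∈ Finset.Ioo (b + i) (b + a) | Above a 0 w}

theorem mem_window {a b i w : ℕ} : w ∈ window a b i ↔ (b + i < w ∧ w < b + a) ∧ Above a 0 w := by
  simp [window]

/-- In the first period, the gaps `2a - 2` and `2a - 1` are missing from the window. As there are
two of them, the parity is not affected. -/
theorem card_window_mod_two {a b i : ℕ} (hb : IsBase a b) (hi : i + 3 ≤ a) :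
    (window a b i).card % 2 = (a + 1 + i) % 2 := by
  rcases hb.eq_or_exists with rfl | ⟨b', hb', rfl⟩
  · have : window b b i = Finset.Ioo (b + i) (2 * b - 2) := by
      ext w
      rw [mem_window, Finset.mem_Ioo]
      unfold Above
      omega
    rw [this, Nat.card_Ioo]
    omega
  · have : window a (b' + 2 * a + 1) i =
        Finset.Ioo (b' + 2 * a + 1 + i) (b' + 2 * a + 1 + a) := by
      ext w
      rw [mem_window, Finset.mem_Ioo]
      unfold Above
      omega
    rw [this, Nat.card_Ioo]
    omega

/-- The positions that player `B` leaves to player `A` for even `a ≥ 8`. With the base `b` of some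
period, they are described by their least removed element `x`, which is `b`, `b + 1`, `b + 2` or
lies in `[b + a, b + 2a - 2]`, and by their elements above `x`. Except for `pair`, the latter form a
subset of the window `(x, x + a)` that is constrained by parities; `L` and `U` stand for its lower
and its upper part. The conditions on `b + a - 3` in `base` and `addTwo` exclude the sets
`{b + a - 3, b + a - 2}` and `{b + a - 3, b + a - 1}`. For `a = 6` such a set would be needed. The
positions `pair` arise when `b + 1` and `b + 2a` have been picked. -/
inductive Target (a : ℕ) : Set ℕ → Prop
  | base {b : ℕ} {T : Finset ℕ} (hb : IsBase a b)
    (hT : ∀ t ∈ T, Above a 0 t ∧ b < t ∧ t < b + a) (hp : T.card % 2 = 0)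
    (hex : b + a - 3 ∈ T → ∃ t ∈ T, t + 4 ≤ b + a) : Target a (pos a b T)
  | succ {b : ℕ} {T : Finset ℕ} (hb : IsBase a b)
    (hT : ∀ t ∈ T, Above a 0 t ∧ b + 1 < t ∧ t < b + a) (hp : T.card % 2 = 1) :
    Target a (pos a (b + 1) T)
  | pair {b : ℕ} (hb : IsBase a b) :
    Target a (pos a (b + 1) (window a b 1 ∪ {b + a, b + 2 * a - 1}))
  | addTwo {b : ℕ} {L U : Finset ℕ} (hb : IsBase a b) (hba : b ≠ a)
    (hL : ∀ t ∈ L, b + 2 < t ∧ t + 1 < b + a) (hp : L.card % 2 = 0)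
    (hex : b + a - 3 ∈ L → ∃ t ∈ L, t + 4 ≤ b + a) (hU : U = ∅ ∨ U = {b + a, b + a + 1}) :
    Target a (pos a (b + 2) (L ∪ U))
  | mid {b : ℕ} {T : Finset ℕ} (hb : IsBase a b)
    (hT : ∀ t ∈ T, b + a < t ∧ t < b + 2 * a) (hp : T.card % 2 = 0) :
    Target a (pos a (b + a) T)
  | midSucc {b : ℕ} {L : Finset ℕ} (hb : IsBase a b)
    (hL : ∀ t ∈ L, b + a + 1 < t ∧ t + 2 < b + 2 * a) (hp : L.card % 2 = 0) :
    Target a (pos a (b + a + 1) (L ∪ {b + 2 * a - 1, b + 2 * a}))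
  | midAdd {b m : ℕ} {L U : Finset ℕ} (hb : IsBase a b) (hm : 2 ≤ m) (hma : m + 2 ≤ a)
    (hL : ∀ t ∈ L, b + a + m < t ∧ t + 1 < b + 2 * a) (hLp : L.card % 2 = m % 2)
    (hU : ∀ t ∈ U, b + 2 * a ≤ t ∧ t < b + 2 * a + m) (hUp : U.card % 2 = 0) :
    Target a (pos a (b + a + m) (L ∪ U))

/-- The player to move can move to a target. -/
def CanReachTarget (a : ℕ) (Q : Set ℕ) : Prop :=
  ∃ y ∈ Q, y ≠ 0 ∧ Target a (bite (intervalSemigroup a (2 * a - 3)) Q y)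

theorem CanReachTarget.of_eq {a : ℕ} {Q R : Set ℕ} (y : ℕ) (hy : y ∈ Q) (hy0 : y ≠ 0)
    (h : bite (intervalSemigroup a (2 * a - 3)) Q y = R) (hR : Target a R) : CanReachTarget a Q :=
  ⟨y, hy, hy0, h ▸ hR⟩

section

variable {a b : ℕ} {T L U : Finset ℕ}

theorem canReachTarget_base (ha : 8 ≤ a) (hb : IsBase a b)
    (hT : ∀ t ∈ T, Above a 0 t ∧ b < t ∧ t < b + a) (hp : T.card % 2 = 1) :
    CanReachTarget a (pos a b T) := by
  obtain ⟨t, ht, hex⟩ := exists_mem_notMem_erase hp (b + a - 3)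
  have hmem := hT t ht
  refine .of_eq t (mem_pos.2 ⟨hmem.1, Or.inr ht⟩) (by omega)
    (bite_pos (by omega) (fun w hw => (hT w hw).2) ht) (.base hb ?_ ?_ fun h => absurd h hex)
  · exact fun w hw => hT w (Finset.mem_of_mem_erase hw)
  · rw [card_erase_mod_two ht]
    omega

theorem canReachTarget_mid (ha : 8 ≤ a) (hb : IsBase a b)
    (hT : ∀ t ∈ T, b + a < t ∧ t < b + 2 * a) (hp : T.card % 2 = 1) :
    CanReachTarget a (pos a (b + a) T) := by
  obtain ⟨t, ht⟩ := nonempty_of_odd hp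
  have hba := hb.le
  have hmem := hT t ht
  refine .of_eq t (mem_pos.2 ⟨by unfold Above; omega, Or.inr ht⟩) (by omega)
    (bite_pos (by omega) (fun w hw => by have := hT w hw; omega) ht) (.mid hb ?_ ?_)
  · exact fun w hw => hT w (Finset.mem_of_mem_erase hw)
  · rw [card_erase_mod_two ht]
    omega

theorem canReachTarget_succ (ha : 8 ≤ a) (hb : IsBase a b)
    (hT : ∀ t ∈ T, Above a 0 t ∧ b + 1 < t ∧ t < b + a) (hp : T.card % 2 = 0) :
    CanReachTarget a (pos a (b + 1) T) := by
  have hba := hb.le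
  rcases T.eq_empty_or_nonempty with rfl | ⟨t, ht⟩
  · refine .of_eq b (mem_pos.2 ?_) (by omega) (R := pos a b ∅) ?_ (.base hb (by simp) (by simp)
      (by simp))
    · have := hb.eq_or_exists
      unfold Above
      grind
    · ext w
      simp only [mem_bite_iff (show 5 ≤ a by omega), mem_pos]
      unfold Above
      grind
  · have hmem := hT t ht
    refine .of_eq t (mem_pos.2 ⟨hmem.1, Or.inr ht⟩) (by omega)
      (bite_pos (by omega) (fun w hw => by have := hT w hw; omega) ht) (.succ hb ?_ ?_)
    · exact fun w hw => hT w (Finset.mem_of_mem_erase hw)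
    · rw [card_erase_mod_two ht]
      omega

/-! ### Moves far below the least removed element -/

/-- The position `Q` contains all elements of the semigroup that are less than `n`. -/
def CompleteBelow (a n : ℕ) (Q : Set ℕ) : Prop :=
  (∀ w ∈ Q, Above a 0 w) ∧ ∀ w, Above a 0 w → w < n → w ∈ Q

variable {Q : Set ℕ} {n z : ℕ}

theorem CompleteBelow.mono {m : ℕ} (h : CompleteBelow a n Q) (hm : m ≤ n) : CompleteBelow a m Q :=
  ⟨h.1, fun w hw hwm => h.2 w hw (by omega)⟩

theorem completeBelow_pos {x : ℕ} : CompleteBelow a x (pos a x T) :=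
  ⟨fun _ hw => hw.1, fun _ hw hwx => ⟨hw, Or.inl hwx⟩⟩

/-- If `z` and `y` differ by at least `2` and at most `a - 2`, then nothing from the lesser one
plus `a` on is left when both are picked, so that what is left of the window is complete. -/
theorem bite_bite_of_completeBelow {y : ℕ} (ha : 5 ≤ a) (hyz : y + 2 ≤ z) (hza : z + 2 ≤ y + a)
    (hQ : CompleteBelow a (y + a) Q) :
    bite (intervalSemigroup a (2 * a - 3)) (bite (intervalSemigroup a (2 * a - 3)) Q z) y =
      pos a y ((window a y 0).erase z) := by
  obtain ⟨hQ₁, hQ₂⟩ := hQ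
  ext w
  simp only [mem_bite_iff ha, mem_pos, Finset.mem_erase, mem_window]
  unfold Above at *
  grind

theorem bite_comm {S : AddSubmonoid ℕ} {y : ℕ} :
    bite S (bite S Q z) y = bite S (bite S Q y) z := by
  ext w
  simp only [bite, Set.mem_ofPred_eq]
  tauto

end

section

variable {a b n z : ℕ} {Q : Set ℕ} {T L U : Finset ℕ}

theorem IsBase.eq_or_le (hb : IsBase a b) : b = a ∨ 3 * a + 1 ≤ b := by
  rcases hb.eq_or_exists with h | ⟨b', hb', rfl⟩
  · exact Or.inl h
  · have := hb'.le
    omega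

theorem target_window_erase (ha : 8 ≤ a) (hev : a % 2 = 0) (hb : IsBase a b) (hz : Above a 0 z)
    (hbz : b < z) (hza : z < b + a) : Target a (pos a b ((window a b 0).erase z)) := by
  have hmem : z ∈ window a b 0 := mem_window.2 ⟨by omega, hz⟩
  have hcard := card_window_mod_two hb (i := 0) (by omega)
  have hba := hb.eq_or_le
  refine .base hb (fun t ht => ?_) ?_ fun _ => ?_
  · have := mem_window.1 (Finset.mem_of_mem_erase ht)
    exact ⟨this.2, by omega⟩
  · rw [card_erase_mod_two hmem]
    omega
  · by_cases hz1 : z = b + 1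
    · refine ⟨b + 2, ?_, by omega⟩
      simp only [Finset.mem_erase, mem_window]
      unfold Above
      omega
    · refine ⟨b + 1, ?_, by omega⟩
      simp only [Finset.mem_erase, mem_window]
      unfold Above
      omega

/-- The moves `b` and `b + j` answer each other if `2 ≤ j ≤ a - 2`. -/
theorem answer_base (ha : 8 ≤ a) (hev : a % 2 = 0) (hb : IsBase a b)
    (hQ : CompleteBelow a (b + a) Q) (hz : Above a 0 z) (hbz : b ≤ z) (hza : z + 2 ≤ b + a)
    (hz1 : z ≠ b + 1) : CanReachTarget a (bite (intervalSemigroup a (2 * a - 3)) Q z) := by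
  have hba := hb.eq_or_le
  have ha5 : 5 ≤ a := by omega
  rcases eq_or_ne z b with rfl | hne
  · refine .of_eq (z + 2) ((mem_bite_iff ha5).2 ⟨hQ.2 _ ?_ ?_, ?_⟩) (by omega)
      (bite_comm.trans (bite_bite_of_completeBelow ha5 le_rfl (by omega) hQ))
      (target_window_erase ha hev hb ?_ (by omega) (by omega))
    all_goals first | (unfold Above; omega) | omega
  · refine .of_eq b ((mem_bite_iff ha5).2 ⟨hQ.2 _ ?_ ?_, ?_⟩) (by omega)
      (bite_bite_of_completeBelow ha5 (by omega) (by omega) hQ)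
      (target_window_erase ha hev hb hz (by omega) (by omega))
    all_goals first | (unfold Above; omega) | omega

/-- The moves `b + a` and `b + a + j` answer each other if `2 ≤ j ≤ a - 2`. -/
theorem answer_mid (ha : 8 ≤ a) (hev : a % 2 = 0) (hb : IsBase a b)
    (hQ : CompleteBelow a (b + 2 * a) Q) (hbz : b + a ≤ z) (hza : z + 2 ≤ b + 2 * a)
    (hz1 : z ≠ b + a + 1) : CanReachTarget a (bite (intervalSemigroup a (2 * a - 3)) Q z) := by
  have hba := hb.le
  have ha5 : 5 ≤ a := by omega
  have key : ∀ y, b + a + 2 ≤ y → y + 2 ≤ b + 2 * a →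
      Target a (pos a (b + a) ((window a (b + a) 0).erase y)) := by
    intro y hy₁ hy₂
    have hw : window a (b + a) 0 = Finset.Ioo (b + a) (b + a + a) := by
      ext w
      rw [mem_window, Finset.mem_Ioo]
      unfold Above
      omega
    have hmem : y ∈ Finset.Ioo (b + a) (b + a + a) := Finset.mem_Ioo.2 (by omega)
    rw [hw]
    refine .mid hb (fun t ht => ?_) ?_
    · have := Finset.mem_Ioo.1 (Finset.mem_of_mem_erase ht)
      omega
    · rw [card_erase_mod_two hmem, Nat.card_Ioo]
      omega
  rcases eq_or_ne z (b + a) with rfl | hne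
  · refine .of_eq (b + a + 2) ((mem_bite_iff ha5).2 ⟨hQ.2 _ ?_ ?_, ?_⟩) (by omega)
      (bite_comm.trans
        (bite_bite_of_completeBelow ha5 le_rfl (by omega) (hQ.mono (by omega))))
      (key _ (by omega) (by omega))
    all_goals first | (unfold Above; omega) | omega
  · refine .of_eq (b + a) ((mem_bite_iff ha5).2 ⟨hQ.2 _ ?_ ?_, ?_⟩) (by omega)
      (bite_bite_of_completeBelow ha5 (by omega) (by omega) (hQ.mono (by omega)))
      (key _ (by omega) (by omega))
    all_goals first | (unfold Above; omega) | omega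

/-- The move `b + a - 1` is answered by `b + 2`. -/
theorem answer_base_last (ha : 8 ≤ a) (hev : a % 2 = 0) (hb : IsBase a b) (hba : b ≠ a)
    (hQ : CompleteBelow a (b + a + 2) Q) :
    CanReachTarget a (bite (intervalSemigroup a (2 * a - 3)) Q (b + a - 1)) := by
  have hle := hb.eq_or_le
  have ha5 : 5 ≤ a := by omega
  have hw : (window a (b + 2) 0).erase (b + a - 1) =
      Finset.Ioo (b + 2) (b + a - 1) ∪ {b + a, b + a + 1} := by
    ext w
    simp only [Finset.mem_erase, mem_window, Finset.mem_union, Finset.mem_Ioo, Finset.mem_insert,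
      Finset.mem_singleton]
    unfold Above
    omega
  refine .of_eq (b + 2) ((mem_bite_iff ha5).2 ⟨hQ.2 _ ?_ (by omega), ?_⟩) (by omega)
    (bite_bite_of_completeBelow ha5 (by omega) (by omega) (hQ.mono (by omega))) ?_
  · unfold Above; omega
  · unfold Above; omega
  rw [hw]
  refine .addTwo hb hba (fun t ht => ?_) ?_ (fun _ => ⟨b + 3, ?_, by omega⟩) (Or.inr rfl)
  · rw [Finset.mem_Ioo] at ht; omega
  · rw [Nat.card_Ioo]; omega
  · rw [Finset.mem_Ioo]; omega

/-- The move `b + a + 1` is answered by `b + 2a - 2`. -/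
theorem answer_mid_succ (ha : 8 ≤ a) (hev : a % 2 = 0) (hb : IsBase a b)
    (hQ : CompleteBelow a (b + 2 * a + 1) Q) :
    CanReachTarget a (bite (intervalSemigroup a (2 * a - 3)) Q (b + a + 1)) := by
  have hle := hb.le
  have ha5 : 5 ≤ a := by omega
  have hw : (window a (b + a + 1) 0).erase (b + 2 * a - 2) =
      Finset.Ioo (b + a + 1) (b + 2 * a - 2) ∪ {b + 2 * a - 1, b + 2 * a} := by
    ext w
    simp only [Finset.mem_erase, mem_window, Finset.mem_union, Finset.mem_Ioo, Finset.mem_insert,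
      Finset.mem_singleton]
    unfold Above
    omega
  refine .of_eq (b + 2 * a - 2) ((mem_bite_iff ha5).2 ⟨hQ.2 _ ?_ (by omega), ?_⟩) (by omega)
    (bite_comm.trans
      (bite_bite_of_completeBelow ha5 (by omega) (by omega) (hQ.mono (by omega)))) ?_
  · unfold Above; omega
  · unfold Above; omega
  rw [hw]
  refine .midSucc hb (fun t ht => ?_) ?_
  · rw [Finset.mem_Ioo] at ht; omega
  · rw [Nat.card_Ioo]; omega

/-- The move `b + 2a - 1` is answered by `b + a + 2`. -/
theorem answer_mid_last (ha : 8 ≤ a) (hev : a % 2 = 0) (hb : IsBase a b)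
    (hQ : CompleteBelow a (b + 2 * a + 2) Q) :
    CanReachTarget a (bite (intervalSemigroup a (2 * a - 3)) Q (b + 2 * a - 1)) := by
  have hle := hb.le
  have ha5 : 5 ≤ a := by omega
  have hw : (window a (b + a + 2) 0).erase (b + 2 * a - 1) =
      Finset.Ioo (b + a + 2) (b + 2 * a - 1) ∪ {b + 2 * a, b + 2 * a + 1} := by
    ext w
    simp only [Finset.mem_erase, mem_window, Finset.mem_union, Finset.mem_Ioo, Finset.mem_insert,
      Finset.mem_singleton]
    unfold Above
    omega
  refine .of_eq (b + a + 2) ((mem_bite_iff ha5).2 ⟨hQ.2 _ ?_ (by omega), ?_⟩) (by omega)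
    (bite_bite_of_completeBelow ha5 (by omega) (by omega) (hQ.mono (by omega))) ?_
  · unfold Above; omega
  · unfold Above; omega
  rw [hw]
  refine .midAdd hb le_rfl (by omega) (fun t ht => ?_) ?_ (fun t ht => ?_) ?_
  · rw [Finset.mem_Ioo] at ht; omega
  · rw [Nat.card_Ioo]; omega
  · simp only [Finset.mem_insert, Finset.mem_singleton] at ht; omega
  · rw [Finset.card_pair (by omega)]

/-- As `2a - 1` is a gap of the semigroup, `b + 1` and `b + 2a` are incomparable. They leave
`b + 2a - 1`, which exceeds `b + 1` by the gap `2a - 2`, and nothing else beyond the window. -/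
theorem bite_bite_pair (ha : 8 ≤ a) (hb : IsBase a b) (hQ : CompleteBelow a (b + a + 1) Q)
    (hmem : b + 2 * a - 1 ∈ Q) :
    bite (intervalSemigroup a (2 * a - 3)) (bite (intervalSemigroup a (2 * a - 3)) Q (b + 1))
      (b + 2 * a) = pos a (b + 1) (window a b 1 ∪ {b + a, b + 2 * a - 1}) := by
  have hba := hb.le
  obtain ⟨hQ₁, hQ₂⟩ := hQ
  ext w
  simp only [mem_bite_iff (show 5 ≤ a by omega), mem_pos, Finset.mem_union, mem_window,
    Finset.mem_insert, Finset.mem_singleton]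
  have h₁ := hQ₁ w
  have h₂ := hQ₂ w
  have h₃ : w = b + 2 * a - 1 → w ∈ Q := fun h => h ▸ hmem
  unfold Above at *
  by_cases hw : w ∈ Q
  · simp only [hw, true_and, forall_const] at *
    omega
  · simp only [hw, false_and, imp_false, false_iff] at *
    omega

/-- The move `b + 1` is answered by `b + 2a`. -/
theorem answer_succ (ha : 8 ≤ a) (hb : IsBase a b) (hQ : CompleteBelow a (b + a + 1) Q)
    (h₁ : b + 2 * a - 1 ∈ Q) (h₂ : b + 2 * a ∈ Q) :
    CanReachTarget a (bite (intervalSemigroup a (2 * a - 3)) Q (b + 1)) := by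
  refine .of_eq (b + 2 * a) ((mem_bite_iff (by omega)).2 ⟨h₂, ?_⟩) (by omega)
    (bite_bite_pair ha hb hQ h₁) (.pair hb)
  unfold Above
  omega

/-- The move `b + 2a` is answered by `b + 1`. -/
theorem answer_mid_add (ha : 8 ≤ a) (hb : IsBase a b) (hQ : CompleteBelow a (b + a + 1) Q)
    (h₁ : b + 2 * a - 1 ∈ Q) :
    CanReachTarget a (bite (intervalSemigroup a (2 * a - 3)) Q (b + 2 * a)) := by
  have hba := hb.eq_or_le
  refine .of_eq (b + 1) ((mem_bite_iff (by omega)).2 ⟨hQ.2 _ ?_ (by omega), ?_⟩) (by omega)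
    (bite_comm.trans (bite_bite_pair ha hb hQ h₁)) (.pair hb)
  · unfold Above
    omega
  · unfold Above
    omega

/-- Every move in a period that lies below the least removed element can be answered:
`b` and `b + j` answer each other for `2 ≤ j ≤ a - 2`, so do `b + a` and `b + a + j`, as well as
`b + 1` and `b + 2a`; the moves `b + a - 1`, `b + a + 1` and `b + 2a - 1` are answered by `b + 2`,
`b + 2a - 2` and `b + a + 2`. The last of these answers affects elements beyond the period. -/
theorem answer_of_period (ha : 8 ≤ a) (hev : a % 2 = 0) (hb : IsBase a b)
    (hQ : CompleteBelow a (b + 2 * a + 1) Q)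
    (hQ' : z = b + 2 * a - 1 → CompleteBelow a (b + 2 * a + 2) Q) (hz : Above a 0 z) (hbz : b ≤ z)
    (hzb : z ≤ b + 2 * a) : CanReachTarget a (bite (intervalSemigroup a (2 * a - 3)) Q z) := by
  have hba := hb.eq_or_le
  have hmem : b + 2 * a - 1 ∈ Q := hQ.2 _ (by unfold Above; omega) (by omega)
  have hmem' : b + 2 * a ∈ Q := hQ.2 _ (by unfold Above; omega) (by omega)
  by_cases h₁ : z = b + 1
  · exact h₁ ▸ answer_succ ha hb (hQ.mono (by omega)) hmem hmem'
  by_cases h₂ : z + 2 ≤ b + a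
  · exact answer_base ha hev hb (hQ.mono (by omega)) hz hbz h₂ h₁
  by_cases h₃ : z = b + a - 1
  · refine h₃ ▸ answer_base_last ha hev hb ?_ (hQ.mono (by omega))
    unfold Above at hz
    omega
  by_cases h₄ : z = b + a + 1
  · exact h₄ ▸ answer_mid_succ ha hev hb (hQ.mono (by omega))
  by_cases h₅ : z + 2 ≤ b + 2 * a
  · exact answer_mid ha hev hb (hQ.mono (by omega)) (by omega) h₅ h₄
  by_cases h₆ : z = b + 2 * a - 1
  · exact h₆ ▸ answer_mid_last ha hev hb (hQ' h₆)
  obtain rfl : z = b + 2 * a := by omega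
  exact answer_mid_add ha hb (hQ.mono (by omega)) hmem

theorem IsBase.add_le_of_lt {b' : ℕ} (hb : IsBase a b) (hb' : IsBase a b') (h : b < b') :
    b + 2 * a + 1 ≤ b' := by
  obtain ⟨k, rfl⟩ := hb
  obtain ⟨k', rfl⟩ := hb'
  have hk : k + 1 ≤ k' := by
    by_contra hlt
    have := Nat.mul_le_mul_right (2 * a + 1) (show k' ≤ k by omega)
    omega
  have := Nat.mul_le_mul_right (2 * a + 1) hk
  rw [add_one_mul] at this
  omega

/-- Every move below the base `b` can be answered, except that for `b - 2` the element `b` must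
not have been removed. -/
theorem answer_of_lt (ha : 8 ≤ a) (hev : a % 2 = 0) (hb : IsBase a b)
    (hQ : CompleteBelow a b Q) (hQ' : z + 2 = b → CompleteBelow a (b + 1) Q) (hz : Above a 0 z)
    (hz0 : z ≠ 0) (hzb : z < b) :
    CanReachTarget a (bite (intervalSemigroup a (2 * a - 3)) Q z) := by
  obtain ⟨b', hb', h₁, h₂⟩ := exists_isBase_le (a := a) (z := z) (by unfold Above at hz; omega)
  have := hb'.add_le_of_lt hb (by omega)
  refine answer_of_period ha hev hb' (hQ.mono (by omega)) (fun h => ?_) hz h₁ h₂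
  by_cases hbb : b = b' + 2 * a + 1
  · exact (hQ' (by omega)).mono (by omega)
  · exact hQ.mono (by omega)

/-- Every first move can be answered. -/
theorem answer_first (ha : 8 ≤ a) (hev : a % 2 = 0) (hQ : ∀ w, w ∈ Q ↔ Above a 0 w)
    (hz : Above a 0 z) (hz0 : z ≠ 0) :
    CanReachTarget a (bite (intervalSemigroup a (2 * a - 3)) Q z) := by
  obtain ⟨b, hb, h₁, h₂⟩ := exists_isBase_le (a := a) (z := z) (by unfold Above at hz; omega)
  have h n : CompleteBelow a n Q := ⟨fun w => (hQ w).1, fun w hw _ => (hQ w).2 hw⟩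
  exact answer_of_period ha hev hb (h _) (fun _ => h _) hz h₁ h₂

end

/-! ### Answers to all moves from the targets -/

section

variable {a b m z : ℕ} {T L U : Finset ℕ}

theorem answer_target_base (ha : 8 ≤ a) (hev : a % 2 = 0) (hb : IsBase a b)
    (hT : ∀ t ∈ T, Above a 0 t ∧ b < t ∧ t < b + a) (hp : T.card % 2 = 0)
    (hex : b + a - 3 ∈ T → ∃ t ∈ T, t + 4 ≤ b + a) (hz : z ∈ pos a b T) (hz0 : z ≠ 0) :
    CanReachTarget a (bite (intervalSemigroup a (2 * a - 3)) (pos a b T) z) := by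
  have ha5 : 5 ≤ a := by omega
  obtain ⟨hzS, hzb | hzT⟩ := hz
  · by_cases hz2 : z + 2 = b
    · obtain rfl | ⟨b, hb', rfl⟩ := hb.eq_or_exists
      · unfold Above at hzS
        omega
      obtain rfl : z = b + 2 * a - 1 := by omega
      have hle := hb'.le
      by_cases hmem : b + 2 * a + 1 + a - 3 ∈ T
      · -- The answer is `τ - a + 1`, where `τ` is the least element of `T`: it removes all of `T`
        -- except `τ`.
        obtain ⟨τ, hτ, hmin⟩ := Finset.exists_min_image T id ⟨_, hmem⟩
        obtain ⟨t, ht, hta⟩ := hex hmem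
        have hτt := hmin t ht
        have hτT := hT τ hτ
        simp only [id] at hmin hτt
        refine .of_eq (τ - a + 1) ((mem_bite_iff ha5).2 ⟨mem_pos.2 ⟨?_, Or.inl (by omega)⟩, ?_⟩)
          (by omega) (R := pos a (b + a + (τ - 2 * a + 1 - b))
            (Finset.Ioo (τ - a + 1) (b + 2 * a - 1) ∪ {b + 2 * a, τ})) ?_
          (.midAdd hb' ?_ ?_ ?_ ?_ ?_ ?_)
        · unfold Above; omega
        · unfold Above; omega
        · ext w
          have h₁ := hT w
          have h₂ := hmin w
          simp only [mem_bite_iff ha5, mem_pos, Finset.mem_union, Finset.mem_Ioo,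
            Finset.mem_insert, Finset.mem_singleton]
          unfold Above at *
          by_cases hwτ : w = τ
          · subst hwτ
            simp only [hτ, or_true, and_true]
            omega
          by_cases hw : w ∈ T
          · simp only [hw, forall_const] at *
            omega
          · simp only [hw, or_false] at *
            omega
        · omega
        · omega
        · intro t ht
          rw [Finset.mem_Ioo] at ht
          omega
        · rw [Nat.card_Ioo]
          omega
        · intro t ht
          rw [Finset.mem_insert, Finset.mem_singleton] at ht
          omega
        · rw [Finset.card_pair (by omega)]
      · refine .of_eq (b + a) ((mem_bite_iff ha5).2 ⟨mem_pos.2 ⟨?_, Or.inl (by omega)⟩, ?_⟩)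
          (by omega) (R := pos a (b + a) (Finset.Ioo (b + a) (b + 2 * a - 1))) ?_
          (.mid hb' ?_ ?_)
        · unfold Above; omega
        · unfold Above; omega
        · ext w
          have h₁ := hT w
          have h₂ : w ∈ T → w ≠ b + 2 * a + 1 + a - 3 := fun h h' => hmem (h' ▸ h)
          simp only [mem_bite_iff ha5, mem_pos, Finset.mem_Ioo]
          unfold Above at *
          by_cases hw : w ∈ T
          · simp only [hw, forall_const] at *
            omega
          · simp only [hw, or_false] at *
            omega
        · intro t ht
          rw [Finset.mem_Ioo] at ht
          omega
        · rw [Nat.card_Ioo]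
          omega
    · exact answer_of_lt ha hev hb completeBelow_pos (fun h => absurd h hz2) hzS hz0 hzb
  · rw [bite_pos ha5 (fun w hw => (hT w hw).2) hzT]
    refine canReachTarget_base ha hb (fun w hw => hT w (Finset.mem_of_mem_erase hw)) ?_
    rw [card_erase_mod_two hzT]
    omega

theorem answer_target_succ (ha : 8 ≤ a) (hev : a % 2 = 0) (hb : IsBase a b)
    (hT : ∀ t ∈ T, Above a 0 t ∧ b + 1 < t ∧ t < b + a) (hp : T.card % 2 = 1)
    (hz : z ∈ pos a (b + 1) T) (hz0 : z ≠ 0) :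
    CanReachTarget a (bite (intervalSemigroup a (2 * a - 3)) (pos a (b + 1) T) z) := by
  have ha5 : 5 ≤ a := by omega
  have hba := hb.eq_or_le
  obtain ⟨hzS, hzb | hzT⟩ := hz
  · by_cases hzb' : z < b
    · exact answer_of_lt ha hev hb (completeBelow_pos.mono (by omega)) (fun _ => completeBelow_pos)
        hzS hz0 hzb'
    obtain rfl : z = b := by omega
    have heq : bite (intervalSemigroup a (2 * a - 3)) (pos a (z + 1) T) z = pos a z T := by
      ext w
      have h₁ := hT w
      simp only [mem_bite_iff ha5, mem_pos]
      unfold Above at *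
      grind
    rw [heq]
    exact canReachTarget_base ha hb (fun t ht => ⟨(hT t ht).1, by have := hT t ht; omega⟩) hp
  · rw [bite_pos ha5 (fun w hw => by have := hT w hw; omega) hzT]
    refine canReachTarget_succ ha hb (fun w hw => hT w (Finset.mem_of_mem_erase hw)) ?_
    rw [card_erase_mod_two hzT]
    omega

theorem target_window_one (ha : 8 ≤ a) (hev : a % 2 = 0) (hb : IsBase a b) :
    Target a (pos a b (window a b 1)) := by
  have hcard := card_window_mod_two hb (i := 1) (by omega)
  have hba := hb.eq_or_le
  refine .base hb (fun t ht => ?_) (by omega) fun _ => ⟨b + 2, ?_, by omega⟩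
  · have := mem_window.1 ht
    exact ⟨this.2, by omega⟩
  · rw [mem_window]
    unfold Above
    omega

theorem target_window_one_erase (ha : 8 ≤ a) (hev : a % 2 = 0) (hb : IsBase a b)
    (hz : z ∈ window a b 1) : Target a (pos a (b + 1) ((window a b 1).erase z)) := by
  have hcard := card_window_mod_two hb (i := 1) (by omega)
  refine .succ hb (fun t ht => ?_) ?_
  · have := mem_window.1 (Finset.mem_of_mem_erase ht)
    exact ⟨this.2, by omega⟩
  · rw [card_erase_mod_two hz]
    omega

theorem answer_target_pair (ha : 8 ≤ a) (hev : a % 2 = 0) (hb : IsBase a b)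
    (hz : z ∈ pos a (b + 1) (window a b 1 ∪ {b + a, b + 2 * a - 1})) (hz0 : z ≠ 0) :
    CanReachTarget a (bite (intervalSemigroup a (2 * a - 3))
      (pos a (b + 1) (window a b 1 ∪ {b + a, b + 2 * a - 1})) z) := by
  have ha5 : 5 ≤ a := by omega
  have hba := hb.eq_or_le
  have hp : b + 2 * a - 1 ∈ pos a (b + 1) (window a b 1 ∪ {b + a, b + 2 * a - 1}) :=
    mem_pos.2 ⟨by unfold Above; omega, by simp⟩
  have hbp : bite (intervalSemigroup a (2 * a - 3)) (bite (intervalSemigroup a (2 * a - 3))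
      (pos a (b + 1) (window a b 1 ∪ {b + a, b + 2 * a - 1})) b) (b + 2 * a - 1) =
      pos a b (window a b 1) := by
    ext w
    simp only [mem_bite_iff ha5, mem_pos, mem_window, Finset.mem_union, Finset.mem_insert,
      Finset.mem_singleton]
    unfold Above at *
    omega
  -- The greater of the two additional elements lies above the whole window.
  have hbw : ∀ t ∈ window a b 1, bite (intervalSemigroup a (2 * a - 3))
      (bite (intervalSemigroup a (2 * a - 3))
      (pos a (b + 1) (window a b 1 ∪ {b + a, b + 2 * a - 1})) t) (b + a) =
      pos a (b + 1) ((window a b 1).erase t) := by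
    intro t ht
    rw [mem_window] at ht
    ext w
    simp only [mem_bite_iff ha5, mem_pos, Finset.mem_erase, mem_window, Finset.mem_union,
      Finset.mem_insert, Finset.mem_singleton]
    unfold Above at *
    omega
  obtain ⟨hzS, hzb | hzT⟩ := hz
  · by_cases hzb' : z < b
    · exact answer_of_lt ha hev hb (completeBelow_pos.mono (by omega)) (fun _ => completeBelow_pos)
        hzS hz0 hzb'
    obtain rfl : z = b := by omega
    refine .of_eq _ ((mem_bite_iff ha5).2 ⟨hp, ?_⟩) (by omega) hbp (target_window_one ha hev hb)
    unfold Above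
    omega
  · simp only [Finset.mem_union, Finset.mem_insert, Finset.mem_singleton] at hzT
    rcases hzT with hzw | rfl | rfl
    · refine .of_eq (b + a) ((mem_bite_iff ha5).2 ⟨mem_pos.2 ⟨?_, by simp⟩, ?_⟩) (by omega)
        (hbw z hzw) (target_window_one_erase ha hev hb hzw)
      · unfold Above
        omega
      · rw [mem_window] at hzw
        unfold Above
        omega
    · have hmem : b + 2 ∈ window a b 1 := by
        rw [mem_window]
        unfold Above
        omega
      refine .of_eq (b + 2) ((mem_bite_iff ha5).2 ⟨mem_pos.2 ⟨?_, by simp [hmem]⟩, ?_⟩) (by omega)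
        (bite_comm.trans (hbw _ hmem)) (target_window_one_erase ha hev hb hmem)
      · unfold Above
        omega
      · unfold Above
        omega
    · refine .of_eq b ((mem_bite_iff ha5).2 ⟨mem_pos.2 ⟨?_, Or.inl (by omega)⟩, ?_⟩) (by omega)
        (bite_comm.trans hbp) (target_window_one ha hev hb)
      · unfold Above
        omega
      · unfold Above
        omega

end

section

variable {a b m z : ℕ} {T L U : Finset ℕ}

theorem answer_target_addTwo (ha : 8 ≤ a) (hev : a % 2 = 0) (hb : IsBase a b) (hba : b ≠ a)
    (hL : ∀ t ∈ L, b + 2 < t ∧ t + 1 < b + a) (hp : L.card % 2 = 0)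
    (hex : b + a - 3 ∈ L → ∃ t ∈ L, t + 4 ≤ b + a) (hU : U = ∅ ∨ U = {b + a, b + a + 1})
    (hz : z ∈ pos a (b + 2) (L ∪ U)) (hz0 : z ≠ 0) :
    CanReachTarget a (bite (intervalSemigroup a (2 * a - 3)) (pos a (b + 2) (L ∪ U)) z) := by
  have ha5 : 5 ≤ a := by omega
  have hle := hb.eq_or_le
  have hU' : ∀ t ∈ U, t = b + a ∨ t = b + a + 1 := by
    rcases hU with rfl | rfl <;> simp
  have hwin : ∀ t ∈ L ∪ U, b + 2 < t ∧ t < b + 2 + a := by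
    intro t ht
    rcases Finset.mem_union.1 ht with h | h
    · have := hL t h
      omega
    · have := hU' t h
      omega
  obtain ⟨hzS, hzb | hzT⟩ := hz
  · by_cases hzb' : z < b
    · exact answer_of_lt ha hev hb (completeBelow_pos.mono (by omega))
        (fun _ => completeBelow_pos.mono (by omega)) hzS hz0 hzb'
    by_cases hz1 : z = b
    · have heq : bite (intervalSemigroup a (2 * a - 3)) (pos a (b + 2) (L ∪ U)) b =
          pos a b (insert (b + 1) L) := by
        ext w
        have h₁ := hL w
        have h₂ := hU' w
        simp only [mem_bite_iff ha5, mem_pos, Finset.mem_union, Finset.mem_insert]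
        unfold Above at *
        by_cases hw : w ∈ L
        · simp only [hw, forall_const, true_or, or_true, and_true] at *
          omega
        · by_cases hw' : w ∈ U
          · simp only [hw, hw', forall_const, or_true, or_false, and_true] at *
            omega
          · simp only [hw, hw', or_false] at *
            omega
      rw [hz1, heq]
      refine canReachTarget_base ha hb (fun t ht => ?_) ?_
      · have := hL t
        rw [Finset.mem_insert] at ht
        unfold Above
        grind
      · rw [Finset.card_insert_of_notMem fun h => by have := hL _ h; omega]
        omega
    obtain rfl : z = b + 1 := by omega
    rcases hU with rfl | rfl
    · have heq : bite (intervalSemigroup a (2 * a - 3)) (pos a (b + 2) (L ∪ ∅)) (b + 1) =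
          pos a (b + 1) L := by
        ext w
        have h₁ := hL w
        simp only [mem_bite_iff ha5, mem_pos, Finset.union_empty]
        unfold Above at *
        by_cases hw : w ∈ L
        · simp only [hw, forall_const, or_true, and_true] at *
          omega
        · simp only [hw, or_false] at *
          omega
      rw [heq]
      refine canReachTarget_succ ha hb (fun t ht => ?_) hp
      have := hL t ht
      unfold Above
      omega
    · refine .of_eq b ((mem_bite_iff ha5).2 ⟨mem_pos.2 ⟨?_, Or.inl (by omega)⟩, ?_⟩) (by omega)
        (R := pos a b L) ?_ (.base hb (fun t ht => ?_) hp hex)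
      · unfold Above
        omega
      · unfold Above
        omega
      · ext w
        have h₁ := hL w
        simp only [mem_bite_iff ha5, mem_pos, Finset.mem_union, Finset.mem_insert,
          Finset.mem_singleton]
        unfold Above at *
        by_cases hw : w ∈ L
        · simp only [hw, forall_const, true_or, or_true, and_true] at *
          omega
        · simp only [hw, false_or, or_false] at *
          omega
      · have := hL t ht
        unfold Above
        omega
  · rw [bite_pos ha5 hwin hzT]
    rcases Finset.mem_union.1 hzT with hzL | hzU
    · have hodd : (L.erase z).card % 2 = 1 := by
        rw [card_erase_mod_two hzL]
        omega
      obtain ⟨t, ht, htn⟩ := exists_mem_notMem_erase hodd (b + a - 3)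
      have htL := hL t (Finset.mem_of_mem_erase ht)
      have hzL' := hL z hzL
      have heq : ((L ∪ U).erase z).erase t = (L.erase z).erase t ∪ U := by
        ext w
        have h₂ := hU' w
        simp only [Finset.mem_erase, Finset.mem_union]
        grind
      have htm : t ∈ (L ∪ U).erase z := by
        simp only [Finset.mem_erase, Finset.mem_union] at ht ⊢
        tauto
      refine .of_eq t (mem_pos.2 ⟨by unfold Above; omega, Or.inr htm⟩) (by omega)
        (bite_pos ha5 (fun w hw => hwin w (Finset.mem_of_mem_erase hw)) htm) ?_
      rw [heq]
      refine .addTwo hb hba (fun w hw => ?_) ?_ (fun h => absurd h htn) hU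
      · exact hL w (Finset.mem_of_mem_erase (Finset.mem_of_mem_erase hw))
      · rw [card_erase_mod_two ht]
        omega
    · obtain rfl | rfl := hU
      · exact absurd hzU (Finset.notMem_empty _)
      -- The two additional elements are removed together.
      obtain ⟨t, ht, htz, heq⟩ : ∃ t ∈ ({b + a, b + a + 1} : Finset ℕ), t ≠ z ∧
          ((L ∪ {b + a, b + a + 1}).erase z).erase t = L ∪ ∅ := by
        rcases hU' z hzU with rfl | rfl
        · refine ⟨b + a + 1, by simp, by omega, ?_⟩
          ext w
          have h₁ := hL w
          simp only [Finset.mem_erase, Finset.mem_union, Finset.mem_insert, Finset.mem_singleton,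
            Finset.union_empty]
          grind
        · refine ⟨b + a, by simp, by omega, ?_⟩
          ext w
          have h₁ := hL w
          simp only [Finset.mem_erase, Finset.mem_union, Finset.mem_insert, Finset.mem_singleton,
            Finset.union_empty]
          grind
      have htU := hU' t ht
      have htm : t ∈ (L ∪ {b + a, b + a + 1}).erase z :=
        Finset.mem_erase.2 ⟨htz, Finset.mem_union_right _ ht⟩
      refine .of_eq t (mem_pos.2 ⟨by unfold Above; omega, Or.inr htm⟩) (by omega)
        (bite_pos ha5 (fun w hw => hwin w (Finset.mem_of_mem_erase hw)) htm) ?_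
      rw [heq]
      exact .addTwo hb hba hL hp hex (Or.inl rfl)

theorem answer_target_mid (ha : 8 ≤ a) (hev : a % 2 = 0) (hb : IsBase a b)
    (hT : ∀ t ∈ T, b + a < t ∧ t < b + 2 * a) (hp : T.card % 2 = 0)
    (hz : z ∈ pos a (b + a) T) (hz0 : z ≠ 0) :
    CanReachTarget a (bite (intervalSemigroup a (2 * a - 3)) (pos a (b + a) T) z) := by
  have ha5 : 5 ≤ a := by omega
  have hle := hb.eq_or_le
  obtain ⟨hzS, hzb | hzT⟩ := hz
  · by_cases hzb' : z < b
    · exact answer_of_lt ha hev hb (completeBelow_pos.mono (by omega))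
        (fun _ => completeBelow_pos.mono (by omega)) hzS hz0 hzb'
    by_cases hz1 : z = b + 1
    · -- The answer removes `b + 2a - 1` if it is left.
      have hcard := card_window_mod_two hb (i := 2) (by omega)
      refine .of_eq (b + 2) ((mem_bite_iff ha5).2 ⟨mem_pos.2 ⟨?_, Or.inl (by omega)⟩, ?_⟩)
        (by omega) (R := pos a (b + 1) (window a b 2)) ?_ (.succ hb (fun t ht => ?_) (by omega))
      · unfold Above
        omega
      · unfold Above
        omega
      · ext w
        have h₁ := hT w
        simp only [mem_bite_iff ha5, mem_pos, mem_window]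
        unfold Above at *
        by_cases hw : w ∈ T
        · simp only [hw, forall_const, or_true, and_true] at *
          omega
        · simp only [hw, or_false] at *
          omega
      · have := mem_window.1 ht
        exact ⟨this.2, by omega⟩
    by_cases hz2 : z = b + a - 1
    · refine .of_eq (b + 1) ((mem_bite_iff ha5).2 ⟨mem_pos.2 ⟨?_, Or.inl (by omega)⟩, ?_⟩)
        (by omega) (R := pos a (b + 1) (Finset.Ioo (b + 1) (b + a - 1))) ?_
        (.succ hb (fun t ht => ?_) ?_)
      · unfold Above at *
        omega
      · unfold Above
        omega
      · ext w
        have h₁ := hT w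
        simp only [mem_bite_iff ha5, mem_pos, Finset.mem_Ioo]
        unfold Above at *
        by_cases hw : w ∈ T
        · simp only [hw, forall_const, or_true, and_true] at *
          omega
        · simp only [hw, or_false] at *
          omega
      · rw [Finset.mem_Ioo] at ht
        unfold Above at *
        omega
      · rw [Nat.card_Ioo]
        omega
    · exact answer_base ha hev hb completeBelow_pos hzS (by omega) (by omega) hz1
  · rw [bite_pos ha5 (fun w hw => by have := hT w hw; omega) hzT]
    refine canReachTarget_mid ha hb (fun w hw => hT w (Finset.mem_of_mem_erase hw)) ?_
    rw [card_erase_mod_two hzT]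
    omega

theorem answer_target_midSucc (ha : 8 ≤ a) (hev : a % 2 = 0) (hb : IsBase a b)
    (hL : ∀ t ∈ L, b + a + 1 < t ∧ t + 2 < b + 2 * a) (hp : L.card % 2 = 0)
    (hz : z ∈ pos a (b + a + 1) (L ∪ {b + 2 * a - 1, b + 2 * a})) (hz0 : z ≠ 0) :
    CanReachTarget a (bite (intervalSemigroup a (2 * a - 3))
      (pos a (b + a + 1) (L ∪ {b + 2 * a - 1, b + 2 * a})) z) := by
  have ha5 : 5 ≤ a := by omega
  have hle := hb.eq_or_le
  have hmem₁ : b + 2 * a - 1 ∈ pos a (b + a + 1) (L ∪ {b + 2 * a - 1, b + 2 * a}) :=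
    mem_pos.2 ⟨by unfold Above; omega, by simp⟩
  have hmem₂ : b + 2 * a ∈ pos a (b + a + 1) (L ∪ {b + 2 * a - 1, b + 2 * a}) :=
    mem_pos.2 ⟨by unfold Above; omega, by simp⟩
  have hwin : ∀ t ∈ L ∪ {b + 2 * a - 1, b + 2 * a}, b + a + 1 < t ∧ t < b + a + 1 + a := by
    intro t ht
    simp only [Finset.mem_union, Finset.mem_insert, Finset.mem_singleton] at ht
    have := hL t
    grind
  obtain ⟨hzS, hzb | hzT⟩ := hz
  · by_cases hzb' : z < b
    · exact answer_of_lt ha hev hb (completeBelow_pos.mono (by omega))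
        (fun _ => completeBelow_pos.mono (by omega)) hzS hz0 hzb'
    by_cases hz1 : z = b + 1
    · exact hz1 ▸ answer_succ ha hb completeBelow_pos hmem₁ hmem₂
    by_cases hz2 : z = b + a - 1
    · refine .of_eq b ((mem_bite_iff ha5).2 ⟨mem_pos.2 ⟨?_, Or.inl (by omega)⟩, ?_⟩)
        (by omega) (R := pos a b (Finset.Ioo b (b + a - 1))) ?_
        (.base hb (fun t ht => ?_) ?_ fun _ => ⟨b + 1, ?_, by omega⟩)
      · unfold Above
        omega
      · unfold Above
        omega
      · ext w
        have h₁ := hL w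
        simp only [mem_bite_iff ha5, mem_pos, Finset.mem_Ioo, Finset.mem_union, Finset.mem_insert,
          Finset.mem_singleton]
        unfold Above at *
        by_cases hw : w ∈ L
        · simp only [hw, forall_const, true_or, or_true, and_true] at *
          omega
        · simp only [hw, false_or] at *
          omega
      · rw [Finset.mem_Ioo] at ht
        unfold Above at *
        omega
      · rw [Nat.card_Ioo]
        omega
      · rw [Finset.mem_Ioo]
        omega
    by_cases hz3 : z = b + a
    · have heq : bite (intervalSemigroup a (2 * a - 3))
          (pos a (b + a + 1) (L ∪ {b + 2 * a - 1, b + 2 * a})) (b + a) =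
          pos a (b + a) (insert (b + 2 * a - 1) L) := by
        ext w
        have h₁ := hL w
        simp only [mem_bite_iff ha5, mem_pos, Finset.mem_union, Finset.mem_insert,
          Finset.mem_singleton]
        unfold Above at *
        by_cases hw : w ∈ L
        · simp only [hw, forall_const, true_or, or_true, and_true] at *
          omega
        · simp only [hw, false_or, or_false] at *
          omega
      rw [hz3, heq]
      refine canReachTarget_mid ha hb (fun t ht => ?_) ?_
      · rcases Finset.mem_insert.1 ht with rfl | ht
        · omega
        · have := hL t ht
          omega
      · rw [Finset.card_insert_of_notMem fun h => by have := hL _ h; omega]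
        omega
    · exact answer_base ha hev hb (completeBelow_pos.mono (by omega)) hzS (by omega) (by omega) hz1
  · simp only [Finset.mem_union, Finset.mem_insert, Finset.mem_singleton] at hzT
    rcases hzT with hzL | rfl | rfl
    · rw [bite_pos ha5 hwin (Finset.mem_union_left _ hzL)]
      have hodd : (L.erase z).card % 2 = 1 := by
        rw [card_erase_mod_two hzL]
        omega
      obtain ⟨t, ht⟩ := nonempty_of_odd hodd
      have htL := hL t (Finset.mem_of_mem_erase ht)
      have hzL' := hL z hzL
      have heq : ((L ∪ {b + 2 * a - 1, b + 2 * a}).erase z).erase t =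
          (L.erase z).erase t ∪ {b + 2 * a - 1, b + 2 * a} := by
        ext w
        simp only [Finset.mem_erase, Finset.mem_union, Finset.mem_insert, Finset.mem_singleton]
        grind
      have htm : t ∈ (L ∪ {b + 2 * a - 1, b + 2 * a}).erase z := by
        simp only [Finset.mem_erase, Finset.mem_union] at ht ⊢
        tauto
      refine .of_eq t (mem_pos.2 ⟨by unfold Above; omega, Or.inr htm⟩) (by omega)
        (bite_pos ha5 (fun w hw => hwin w (Finset.mem_of_mem_erase hw)) htm) ?_
      rw [heq]
      refine .midSucc hb (fun w hw => ?_) ?_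
      · exact hL w (Finset.mem_of_mem_erase (Finset.mem_of_mem_erase hw))
      · rw [card_erase_mod_two ht]
        omega
    · refine .of_eq (b + a) ((mem_bite_iff ha5).2 ⟨mem_pos.2 ⟨?_, Or.inl (by omega)⟩, ?_⟩)
        (by omega) (R := pos a (b + a) L) ?_ (.mid hb (fun t ht => ?_) hp)
      · unfold Above
        omega
      · unfold Above
        omega
      · ext w
        have h₁ := hL w
        simp only [mem_bite_iff ha5, mem_pos, Finset.mem_union, Finset.mem_insert,
          Finset.mem_singleton]
        unfold Above at *
        by_cases hw : w ∈ L
        · simp only [hw, forall_const, true_or, or_true, and_true] at *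
          omega
        · simp only [hw, false_or, or_false] at *
          omega
      · have := hL t ht
        omega
    · exact answer_mid_add ha hb completeBelow_pos hmem₁

theorem answer_target_midAdd (ha : 8 ≤ a) (hev : a % 2 = 0) (hb : IsBase a b) (hm : 2 ≤ m)
    (hma : m + 2 ≤ a) (hL : ∀ t ∈ L, b + a + m < t ∧ t + 1 < b + 2 * a)
    (hLp : L.card % 2 = m % 2) (hU : ∀ t ∈ U, b + 2 * a ≤ t ∧ t < b + 2 * a + m)
    (hUp : U.card % 2 = 0) (hz : z ∈ pos a (b + a + m) (L ∪ U)) (hz0 : z ≠ 0) :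
    CanReachTarget a (bite (intervalSemigroup a (2 * a - 3)) (pos a (b + a + m) (L ∪ U)) z) := by
  have ha5 : 5 ≤ a := by omega
  have hle := hb.eq_or_le
  have hwin : ∀ t ∈ L ∪ U, b + a + m < t ∧ t < b + a + m + a := by
    intro t ht
    rcases Finset.mem_union.1 ht with h | h
    · have := hL t h
      omega
    · have := hU t h
      omega
  have hdisj : Disjoint (Finset.Ioo (b + a) (b + a + m)) L := by
    rw [Finset.disjoint_left]
    intro t ht htL
    have := hL t htL
    rw [Finset.mem_Ioo] at ht
    omega
  obtain ⟨hzS, hzb | hzT⟩ := hz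
  · by_cases hzb' : z < b
    · exact answer_of_lt ha hev hb (completeBelow_pos.mono (by omega))
        (fun _ => completeBelow_pos.mono (by omega)) hzS hz0 hzb'
    by_cases hz1 : z = b + 1
    · -- As `b + 2a - 1` is not left, `b` removes what remains beyond the window of `b + 1`.
      refine .of_eq b ((mem_bite_iff ha5).2 ⟨mem_pos.2 ⟨?_, Or.inl (by omega)⟩, ?_⟩)
        (by omega) (R := pos a b (window a b 1)) ?_ (target_window_one ha hev hb)
      · unfold Above
        omega
      · unfold Above
        omega
      · ext w
        have h₁ := hL w
        have h₂ := hU w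
        simp only [mem_bite_iff ha5, mem_pos, mem_window, Finset.mem_union]
        unfold Above at *
        by_cases hw : w ∈ L
        · simp only [hw, forall_const, true_or, or_true, and_true] at *
          omega
        · by_cases hw' : w ∈ U
          · simp only [hw, hw', forall_const, or_true, and_true] at *
            omega
          · simp only [hw, hw', or_false] at *
            omega
    by_cases hz2 : z = b + a - 1
    · refine hz2 ▸ answer_base_last ha hev hb ?_ (completeBelow_pos.mono (by omega))
      unfold Above at hzS
      omega
    by_cases hz3 : z < b + a
    · exact answer_base ha hev hb (completeBelow_pos.mono (by omega)) hzS (by omega) (by omega) hz1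
    by_cases hz4 : z = b + a
    · have heq : bite (intervalSemigroup a (2 * a - 3)) (pos a (b + a + m) (L ∪ U)) (b + a) =
          pos a (b + a) (Finset.Ioo (b + a) (b + a + m) ∪ L) := by
        ext w
        have h₁ := hL w
        have h₂ := hU w
        simp only [mem_bite_iff ha5, mem_pos, Finset.mem_Ioo, Finset.mem_union]
        unfold Above at *
        by_cases hw : w ∈ L
        · simp only [hw, forall_const, true_or, or_true, and_true] at *
          omega
        · by_cases hw' : w ∈ U
          · simp only [hw, hw', forall_const, or_true, or_false, and_true] at *
            omega
          · simp only [hw, hw', or_false] at *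
            omega
      rw [hz4, heq]
      refine canReachTarget_mid ha hb (fun t ht => ?_) ?_
      · rcases Finset.mem_union.1 ht with h | h
        · rw [Finset.mem_Ioo] at h
          omega
        · have := hL t h
          omega
      · rw [Finset.card_union_of_disjoint hdisj, Nat.card_Ioo]
        omega
    · have hzm : z ∈ Finset.Ioo (b + a) (b + a + m) := Finset.mem_Ioo.2 (by omega)
      refine .of_eq (b + a) ((mem_bite_iff ha5).2 ⟨mem_pos.2 ⟨?_, Or.inl (by omega)⟩, ?_⟩)
        (by omega) (R := pos a (b + a) ((Finset.Ioo (b + a) (b + a + m)).erase z ∪ L)) ?_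
        (.mid hb (fun t ht => ?_) ?_)
      · unfold Above
        omega
      · unfold Above
        omega
      · ext w
        have h₁ := hL w
        have h₂ := hU w
        simp only [mem_bite_iff ha5, mem_pos, Finset.mem_Ioo, Finset.mem_union, Finset.mem_erase]
        unfold Above at *
        by_cases hw : w ∈ L
        · simp only [hw, forall_const, true_or, or_true, and_true] at *
          omega
        · by_cases hw' : w ∈ U
          · simp only [hw, hw', forall_const, or_true, or_false, and_true] at *
            omega
          · simp only [hw, hw', or_false] at *
            omega
      · rcases Finset.mem_union.1 ht with h | h
        · rw [Finset.mem_erase, Finset.mem_Ioo] at h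
          omega
        · have := hL t h
          omega
      · rw [Finset.card_union_of_disjoint (hdisj.mono_left (Finset.erase_subset _ _)),
          Finset.card_erase_of_mem hzm, Nat.card_Ioo]
        omega
  · rw [bite_pos ha5 hwin hzT]
    rcases Finset.mem_union.1 hzT with hzL | hzU
    · have hzL' := hL z hzL
      rcases (L.erase z).eq_empty_or_nonempty with hempty | ⟨t, ht⟩
      · -- Here `L = {z}`, so that `m` is odd.
        have hcard := Finset.card_erase_add_one hzL
        rw [hempty, Finset.card_empty] at hcard
        refine .of_eq (b + a) (mem_pos.2 ⟨?_, Or.inl (by omega)⟩)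
          (by omega) (R := pos a (b + a) (Finset.Ioo (b + a) (b + a + m))) ?_
          (.mid hb (fun t ht => ?_) ?_)
        · unfold Above
          omega
        · ext w
          have h₁ : w ∈ L → w = z := fun h => by
            by_contra hne
            have := Finset.mem_erase.2 ⟨hne, h⟩
            rw [hempty] at this
            exact Finset.notMem_empty _ this
          have h₂ := hU w
          simp only [mem_bite_iff ha5, mem_pos, Finset.mem_Ioo, Finset.mem_union, Finset.mem_erase]
          unfold Above at *
          by_cases hw : w ∈ L
          · simp only [hw, forall_const, true_or, and_true] at *
            omega
          · by_cases hw' : w ∈ U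
            · simp only [hw, hw', forall_const, or_true, and_true] at *
              omega
            · simp only [hw, hw', or_false, and_false] at *
              omega
        · rw [Finset.mem_Ioo] at ht
          omega
        · rw [Nat.card_Ioo]
          omega
      · have htL := hL t (Finset.mem_of_mem_erase ht)
        have heq : ((L ∪ U).erase z).erase t = (L.erase z).erase t ∪ U := by
          ext w
          have h₂ := hU w
          simp only [Finset.mem_erase, Finset.mem_union]
          grind
        have htm : t ∈ (L ∪ U).erase z := by
          simp only [Finset.mem_erase, Finset.mem_union] at ht ⊢
          tauto
        refine .of_eq t (mem_pos.2 ⟨by unfold Above; omega, Or.inr htm⟩) (by omega)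
          (bite_pos ha5 (fun w hw => hwin w (Finset.mem_of_mem_erase hw)) htm) ?_
        rw [heq]
        refine .midAdd hb hm hma (fun w hw => ?_) ?_ hU hUp
        · exact hL w (Finset.mem_of_mem_erase (Finset.mem_of_mem_erase hw))
        · have := card_erase_mod_two hzL
          rw [card_erase_mod_two ht]
          omega
    · have hzU' := hU z hzU
      have hodd : (U.erase z).card % 2 = 1 := by
        rw [card_erase_mod_two hzU]
        omega
      obtain ⟨t, ht⟩ := nonempty_of_odd hodd
      have htU := hU t (Finset.mem_of_mem_erase ht)
      have heq : ((L ∪ U).erase z).erase t = L ∪ (U.erase z).erase t := by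
        ext w
        have h₂ := hL w
        simp only [Finset.mem_erase, Finset.mem_union]
        grind
      have htm : t ∈ (L ∪ U).erase z := by
        simp only [Finset.mem_erase, Finset.mem_union] at ht ⊢
        tauto
      refine .of_eq t (mem_pos.2 ⟨by unfold Above; omega, Or.inr htm⟩) (by omega)
        (bite_pos ha5 (fun w hw => hwin w (Finset.mem_of_mem_erase hw)) htm) ?_
      rw [heq]
      refine .midAdd hb hm hma hL hLp (fun w hw => ?_) ?_
      · exact hU w (Finset.mem_of_mem_erase (Finset.mem_of_mem_erase hw))
      · rw [card_erase_mod_two ht]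
        omega

theorem isClosedFamily_target (ha : 8 ≤ a) (hev : a % 2 = 0) :
    IsClosedFamily (intervalSemigroup a (2 * a - 3)) {Q | Target a Q} := by
  rintro Q hQ z hz hz0
  cases hQ with
  | base hb hT hp hex => exact answer_target_base ha hev hb hT hp hex hz hz0
  | succ hb hT hp => exact answer_target_succ ha hev hb hT hp hz hz0
  | pair hb => exact answer_target_pair ha hev hb hz hz0
  | addTwo hb hba hL hp hex hU => exact answer_target_addTwo ha hev hb hba hL hp hex hU hz hz0
  | mid hb hT hp => exact answer_target_mid ha hev hb hT hp hz hz0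
  | midSucc hb hL hp => exact answer_target_midSucc ha hev hb hL hp hz hz0
  | midAdd hb hm hma hL hLp hU hUp =>
    exact answer_target_midAdd ha hev hb hm hma hL hLp hU hUp hz hz0

/-- For even `a ≥ 8`, player `B` answers every first move by a move to a target. -/
theorem not_playerAWins_of_even (ha : 8 ≤ a) (hev : a % 2 = 0) :
    ¬ PlayerAWins (SemigroupPoset (intervalSemigroup a (2 * a - 3))) := by
  refine not_playerAWins_of_lost fun x hx hx0 => ?_
  have hS : ∀ w, w ∈ (intervalSemigroup a (2 * a - 3) : Set ℕ) ↔ Above a 0 w :=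
    fun w => mem_intervalSemigroup_iff (by omega)
  obtain ⟨y, hy, hy0, hT⟩ := answer_first ha hev hS ((hS x).1 hx) hx0
  exact ⟨y, hy, hy0, _, isClosedFamily_target ha hev, hT⟩

end

/-! ### The case of odd `a` -/

/-- For odd `a`, what is left after the first move `a` is lost: the elements of `[a + 1, 2a - 3]`
are even in number and incomparable; `3a - 2` lies above all of them, and `3a - 1` above all but
`a + 1`. Both of these disappear in the next round, which leaves an even number of incomparable
elements above `0`. -/
theorem lost_bite_self_of_odd {a : ℕ} (ha : 5 ≤ a) (hodd : a % 2 = 1) :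
    Lost (intervalSemigroup a (2 * a - 3))
      (bite (intervalSemigroup a (2 * a - 3)) (intervalSemigroup a (2 * a - 3)) a) := by
  have hfirst : bite (intervalSemigroup a (2 * a - 3)) (intervalSemigroup a (2 * a - 3)) a =
      pos a a (Finset.Ioo a (2 * a - 2) ∪ {3 * a - 2, 3 * a - 1}) := by
    ext w
    rw [mem_bite_iff ha, SetLike.mem_coe, mem_intervalSemigroup_iff ha]
    simp only [mem_pos, Finset.mem_union, Finset.mem_Ioo, Finset.mem_insert, Finset.mem_singleton]
    unfold Above
    omega
  have hanti : ∀ T : Finset ℕ, (∀ t ∈ T, a < t ∧ t < 2 * a - 2) → T.card % 2 = 0 →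
      Lost (intervalSemigroup a (2 * a - 3)) (pos a a T) := by
    intro T hT hp
    refine ⟨{Q | ∃ T : Finset ℕ, (∀ t ∈ T, a < t ∧ t < 2 * a - 2) ∧ T.card % 2 = 0 ∧
      Q = pos a a T}, ?_, T, hT, hp, rfl⟩
    rintro _ ⟨T, hT, hp, rfl⟩ z ⟨hzS, hz⟩ hz0
    have hzT : z ∈ T := by
      rcases hz with hz | hz
      · unfold Above at hzS
        omega
      · exact hz
    have hcard := card_erase_mod_two hzT
    obtain ⟨t, ht⟩ := nonempty_of_odd (T := T.erase z) (by omega)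
    have htT := hT t (Finset.mem_of_mem_erase ht)
    rw [bite_pos ha (fun w hw => by have := hT w hw; omega) hzT]
    refine ⟨t, mem_pos.2 ⟨by unfold Above; omega, Or.inr ht⟩, by omega, (T.erase z).erase t,
      fun w hw => hT w (Finset.mem_of_mem_erase (Finset.mem_of_mem_erase hw)), ?_, ?_⟩
    · rw [card_erase_mod_two ht]
      omega
    · exact bite_pos ha
        (fun w hw => by have := hT w (Finset.mem_of_mem_erase hw); omega) ht
  rw [hfirst]
  refine Lost.of_exists_reply fun z hz hz0 => ?_
  have hz' : (a < z ∧ z < 2 * a - 2) ∨ z = 3 * a - 2 ∨ z = 3 * a - 1 := by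
    simp only [mem_pos, Finset.mem_union, Finset.mem_Ioo, Finset.mem_insert,
      Finset.mem_singleton] at hz
    unfold Above at hz
    omega
  -- `a + 1` and the other elements of the interval answer each other, and so do the two last ones.
  obtain ⟨y, hy, hzy, T, hT, hp, heq⟩ : ∃ y, ((a < y ∧ y < 2 * a - 2) ∨ y = 3 * a - 2 ∨
      y = 3 * a - 1) ∧ ¬ Above a z y ∧ ∃ T : Finset ℕ, (∀ t ∈ T, a < t ∧ t < 2 * a - 2) ∧
      T.card % 2 = 0 ∧ bite (intervalSemigroup a (2 * a - 3)) (bite (intervalSemigroup a (2 * a - 3))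
        (pos a a (Finset.Ioo a (2 * a - 2) ∪ {3 * a - 2, 3 * a - 1})) z) y = pos a a T := by
    have hmid : ∀ t, a + 1 < t → t < 2 * a - 2 →
        bite (intervalSemigroup a (2 * a - 3)) (bite (intervalSemigroup a (2 * a - 3))
          (pos a a (Finset.Ioo a (2 * a - 2) ∪ {3 * a - 2, 3 * a - 1})) t) (a + 1) =
          pos a a ((Finset.Ioo (a + 1) (2 * a - 2)).erase t) := by
      intro t ht₁ ht₂
      ext w
      simp only [mem_bite_iff ha, mem_pos, Finset.mem_union, Finset.mem_Ioo, Finset.mem_insert,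
        Finset.mem_singleton, Finset.mem_erase]
      unfold Above
      omega
    have hcard : ∀ t, a + 1 < t → t < 2 * a - 2 →
        ((Finset.Ioo (a + 1) (2 * a - 2)).erase t).card % 2 = 0 := by
      intro t ht₁ ht₂
      rw [card_erase_mod_two (Finset.mem_Ioo.2 ⟨ht₁, ht₂⟩), Nat.card_Ioo]
      omega
    have hsub : ∀ t, ∀ w ∈ (Finset.Ioo (a + 1) (2 * a - 2)).erase t, a < w ∧ w < 2 * a - 2 := by
      intro t w hw
      rw [Finset.mem_erase, Finset.mem_Ioo] at hw
      omega
    have htop : bite (intervalSemigroup a (2 * a - 3)) (bite (intervalSemigroup a (2 * a - 3))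
        (pos a a (Finset.Ioo a (2 * a - 2) ∪ {3 * a - 2, 3 * a - 1})) (3 * a - 2)) (3 * a - 1) =
        pos a a (Finset.Ioo a (2 * a - 2)) := by
      ext w
      simp only [mem_bite_iff ha, mem_pos, Finset.mem_union, Finset.mem_Ioo, Finset.mem_insert,
        Finset.mem_singleton]
      unfold Above
      omega
    have hcard' : (Finset.Ioo a (2 * a - 2)).card % 2 = 0 := by
      rw [Nat.card_Ioo]
      omega
    rcases hz' with hz' | rfl | rfl
    · rcases eq_or_ne z (a + 1) with rfl | hz1
      · exact ⟨a + 2, by omega, by unfold Above; omega, _, hsub (a + 2),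
          hcard (a + 2) (by omega) (by omega),
          bite_comm.trans (hmid (a + 2) (by omega) (by omega))⟩
      · exact ⟨a + 1, by omega, by unfold Above; omega, _, hsub z, hcard z (by omega) (by omega),
          hmid z (by omega) (by omega)⟩
    · exact ⟨3 * a - 1, by omega, by unfold Above; omega, _, fun t => Finset.mem_Ioo.1, hcard',
        htop⟩
    · exact ⟨3 * a - 2, by omega, by unfold Above; omega, _, fun t => Finset.mem_Ioo.1, hcard',
        bite_comm.trans htop⟩
  refine ⟨y, (mem_bite_iff ha).2 ⟨mem_pos.2 ⟨by unfold Above; omega, Or.inr ?_⟩, hzy⟩, by omega,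
    heq ▸ hanti T hT hp⟩
  simp only [Finset.mem_union, Finset.mem_Ioo, Finset.mem_insert, Finset.mem_singleton]
  exact hy

theorem playerAWins_of_odd {a : ℕ} (ha : 5 ≤ a) (hodd : a % 2 = 1) :
    PlayerAWins (SemigroupPoset (intervalSemigroup a (2 * a - 3))) :=
  playerAWins_of_lost (fun _ _ _ => finite_bite ha)
    ((mem_intervalSemigroup_iff ha).2 (Or.inr (Or.inl ⟨by omega, by omega⟩))) (by omega)
    (lost_bite_self_of_odd ha hodd)

/-! ### The case `a = 6` -/

/-- The finite set of natural numbers whose binary indicator is `n`. -/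
def bitSet (n : ℕ) : Set ℕ := {w | n.testBit w = true}

/-- The indicator of the elements of `⟨6, 7, 8, 9⟩` below `64`. -/
def bitsSix : ℕ := 0xfffffffffffff3c1

/-- The move `z` in terms of indicators. -/
def biteBits (n z : ℕ) : ℕ := n ^^^ (n &&& (bitsSix <<< z))

/-- Indicators of the positions to which player `A` can restrict player `B` for `a = 6`. The first
one is the position after the first move `36`. -/
def lostSix : List ℕ :=
  [0xc3effffff3c1, 0x3cffffff3c1, 0x24ffffff3c1, 0x1effffff3c1, 0x1a7fffff3c1, 0x18ffffff3c1,
   0x167fffff3c1, 0xe7fffff3c1, 0x69fffff3c1, 0x27fffff3c1, 0x24fffff3c1, 0x22fffff3c1,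
   0x21fffff3c1, 0xffffff3c1, 0xebffff3c1, 0xcfffff3c1, 0xafffff3c1, 0x9fffff3c1, 0x8bffff3c1,
   0x6fffff3c1, 0x61ffff3c1, 0xfffff3c1, 0xdbfff3c1, 0xc3fff3c1, 0x75fff3c1, 0x51fff3c1,
   0x43eff3c1, 0x3dfff3c1, 0x3bfff3c1, 0x37fff3c1, 0x2efff3c1, 0x25fff3c1, 0x1ffff3c1,
   0x19fff3c1, 0x13fff3c1, 0xc7ff3c1, 0xbfff3c1, 0xabff3c1, 0x6bff3c1, 0x2cff3c1, 0x1fff3c1,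
   0x1e7f3c1, 0x1d7f3c1, 0x1b7f3c1, 0x1aff3c1, 0x177f3c1, 0x16ff3c1, 0x127f3c1, 0x117f3c1,
   0xf7f3c1, 0xeff3c1, 0xbff3c1, 0xa7f3c1, 0x97f3c1, 0x8ff3c1, 0x7ff3c1, 0x4ff3c1, 0x45f3c1,
   0x37f3c1, 0x1573c1, 0xdb3c1, 0x7f3c1, 0x753c1, 0x6b3c1, 0x613c1, 0x2e3c1, 0x21341, 0x1e3c1,
   0x1d3c1, 0x1b3c1, 0x183c1, 0x173c1, 0x143c1, 0x123c1, 0xf3c1, 0xc3c1, 0xa3c1, 0x63c1, 0x3c1,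
   0x301, 0x281, 0x241, 0x181, 0x141, 0x1]

/-- The least element of the set with the indicator `n ≠ 0`. -/
def leastBit (n : ℕ) : ℕ := (n &&& (n ^^^ (n - 1))).log2

/-- The position `m` has a move `y ≠ 0` to some `p` in `lostSix`. This move can be read off from
`p`: it is the least element removed. The first condition is redundant and serves to discard most
candidates `p` at once. -/
def reachesLostSix (m : ℕ) : Bool :=
  lostSix.any fun p => p &&& m == p && leastBit (m ^^^ p) != 0 &&
    m.testBit (leastBit (m ^^^ p)) && biteBits m (leastBit (m ^^^ p)) == p

/-- The value `f n`. The case distinction makes the kernel evaluate `n` before it unfolds `f`. -/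
def applyToValue (f : ℕ → Bool) : ℕ → Bool
  | 0 => f 0
  | n + 1 => f (n + 1)

theorem applyToValue_eq (f : ℕ → Bool) (n : ℕ) : applyToValue f n = f n := by
  cases n <;> rfl

/-- The positions in `lostSix` have elements less than `48 = 36 + 12` only, and every move `z ≠ 0`
from one of them has an answer that leads back to `lostSix`. -/
def checkSix : Bool :=
  lostSix.all fun n => decide (n < 2 ^ 48) && (List.range 48).all fun z =>
    z == 0 || !n.testBit z || applyToValue reachesLostSix (biteBits n z)

theorem checkSix_eq_true : checkSix = true := by decide +kernel

theorem testBit_bitsSix {d : ℕ} (hd : d < 64) : bitsSix.testBit d = true ↔ Above 6 0 d := by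
  unfold Above
  revert d
  decide

theorem testBit_biteBits {n z w : ℕ} (hw : w < 64) :
    (biteBits n z).testBit w = true ↔ n.testBit w = true ∧ ¬ Above 6 z w := by
  have hab : Above 6 z w ↔ z ≤ w ∧ Above 6 0 (w - z) := by
    unfold Above
    omega
  rw [hab, ← testBit_bitsSix (show w - z < 64 by omega), biteBits, Nat.testBit_xor,
    Nat.testBit_and, Nat.testBit_shiftLeft]
  by_cases hz : z ≤ w <;> cases n.testBit w <;> cases bitsSix.testBit (w - z) <;> simp [hz]

theorem bite_bite_bitSet {n z y : ℕ} (hn : n < 2 ^ 48) :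
    bite (intervalSemigroup 6 (2 * 6 - 3)) (bite (intervalSemigroup 6 (2 * 6 - 3)) (bitSet n) z) y =
      bitSet (biteBits (biteBits n z) y) := by
  ext w
  rw [mem_bite_iff (by norm_num), mem_bite_iff (by norm_num)]
  by_cases hw : w < 64
  · simp only [bitSet, Set.mem_ofPred_eq, testBit_biteBits hw]
  · have hlt : n < 2 ^ w := hn.trans (Nat.pow_lt_pow_right (by norm_num) (by omega))
    simp [bitSet, biteBits, Nat.testBit_lt_two_pow hlt]

theorem isClosedFamily_lostSix :
    IsClosedFamily (intervalSemigroup 6 (2 * 6 - 3)) {Q | ∃ n ∈ lostSix, Q = bitSet n} := by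
  have hcheck := checkSix_eq_true
  simp only [checkSix, List.all_eq_true, Bool.and_eq_true, decide_eq_true_eq, List.mem_range,
    Bool.or_eq_true, beq_iff_eq, Bool.not_eq_true', applyToValue_eq] at hcheck
  rintro _ ⟨n, hn, rfl⟩ z hz hz0
  obtain ⟨hlt, hn⟩ := hcheck n hn
  have hbit : ∀ w, n.testBit w = true → w < 48 := by
    intro w hw
    by_contra hge
    rw [Nat.testBit_lt_two_pow
      (hlt.trans_le (Nat.pow_le_pow_right (by norm_num) (not_lt.1 hge)))] at hw
    exact Bool.false_ne_true hw
  have hz48 := hbit z hz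
  rcases hn z hz48 with (h | h) | h
  · exact absurd h hz0
  · exact absurd (h.symm.trans hz) Bool.false_ne_true
  · simp only [reachesLostSix, List.any_eq_true, Bool.and_eq_true, bne_iff_ne, beq_iff_eq] at h
    obtain ⟨p, hp, ⟨⟨-, hy0⟩, hy⟩, heq⟩ := h
    refine ⟨_, (mem_bite_iff (by norm_num)).2 ?_, hy0, p, hp, ?_⟩
    · have hy64 : leastBit (biteBits n z ^^^ p) < 64 := by
        by_contra hge
        have hlt' : n < 2 ^ leastBit (biteBits n z ^^^ p) :=
          hlt.trans (Nat.pow_lt_pow_right (by norm_num) (by omega))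
        nth_rewrite 1 [biteBits] at hy
        rw [Nat.testBit_xor, Nat.testBit_and, Nat.testBit_lt_two_pow hlt'] at hy
        exact Bool.false_ne_true hy
      exact (testBit_biteBits hy64).1 hy
    · rw [bite_bite_bitSet hlt, heq]

/-- For `a = 6` the first move `36` wins. -/
theorem playerAWins_six : PlayerAWins (SemigroupPoset (intervalSemigroup 6 (2 * 6 - 3))) := by
  refine playerAWins_of_lost (x := 36) (fun _ _ _ => finite_bite (by norm_num)) ?_ (by norm_num)
    ⟨_, isClosedFamily_lostSix, lostSix.head (by decide), List.head_mem _, ?_⟩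
  · rw [mem_intervalSemigroup_iff (by norm_num)]
    unfold Above
    norm_num
  · ext w
    rw [mem_bite_iff (by norm_num), SetLike.mem_coe, mem_intervalSemigroup_iff (by norm_num)]
    by_cases hw : w < 64
    · unfold bitSet Above
      rw [Set.mem_ofPred_eq]
      revert w
      decide
    · have hlt : lostSix.head (by decide) < 2 ^ w :=
        lt_of_lt_of_le (show lostSix.head (by decide) < 2 ^ 64 by decide)
          (Nat.pow_le_pow_right (by norm_num) (not_lt.1 hw))
      unfold bitSet Above
      rw [Set.mem_ofPred_eq, Nat.testBit_lt_two_pow hlt]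
      simp only [Bool.false_eq_true, iff_false]
      omega

end Chomp

theorem mainTheorem6 (a : ℕ) (ha : 4 ≤ a) :
    Chomp.PlayerAWins (SemigroupPoset (intervalSemigroup a (2 * a - 3))) ↔ (Odd a ∨ a = 6) := by
  rcases Nat.even_or_odd a with hev | hodd
  · have hmod := Nat.even_iff.1 hev
    rw [or_iff_right (Nat.not_odd_iff_even.2 hev)]
    refine ⟨fun h => ?_, ?_⟩
    · by_contra h6
      rcases ha.eq_or_lt with rfl | h4
      · exact Chomp.not_playerAWins_four h
      · exact Chomp.not_playerAWins_of_even (by omega) hmod h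
    · rintro rfl
      exact Chomp.playerAWins_six
  · have hmod := Nat.odd_iff.1 hodd
    exact iff_of_true (Chomp.playerAWins_of_odd (by omega) hmod) (Or.inl hodd)
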